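/- Let $\mathbb F_q$ be a finite field of characteristic $p$ with $q\equiv 1\pmod 6$. Multiplicative characters $\chi:\mathbb F_q^\times\to\mathbb C^\times$ form the group $\widehat{\mathbb F_q^\times}$ and are extended to $\mathbb F_q$ by $\chi(0)=0$ (also for the trivial character $\varepsilon$); $\overline\chi$ is the complex conjugate, and $\phi$ is the quadratic character. Fix a primitive $p$-th root of unity $\zeta_p\in\mathbb C$ and put $$g(\chi)=\sum_{x\in\mathbb F_q^\times}\chi(x)\zeta_p^{\mathrm{Tr}_{\mathbb F_q/\mathbb F_p}(x)},\qquad J(\chi,\psi)=\sum_{x\in\mathbb F_q}\chi(x)\psi(1-x),$$ and let $\delta(0)=1$, $\delta(x)=0$ for $x\in\mathbb F_q^\times$. Define recursively ${}_1\mathbb P_0[A_1;t]=\overline{A_1}(1-t)$ and $${}_{n+1}\mathbb P_n\left[\begin{matrix}A_1&\cdots&A_{n+1}\\&B_1\cdots&B_n\end{matrix};t\right]=\sum_{y\in\mathbb F_q}A_{n+1}(y)\,\overline{A_{n+1}}B_n(1-y)\;{}_n\mathbb P_{n-1}\left[\begin{matrix}A_1&\cdots&A_n\\&B_1\cdots&B_{n-1}\end{matrix};ty\right],$$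 and the normalized function ${}_{n+1}\mathbb F_n=\Big(\prod_{i=1}^nJ(A_{i+1},B_i\overline{A_{i+1}})\Big)^{-1}{}_{n+1}\mathbb P_n$. Let $\eta$ be a multiplicative character of order $3$, and let $A,B\in\widehat{\mathbb F_q^\times}$ be such that none of $A^3$, $B$, $A^3\overline B^2$, $A^6\overline B^3$, $\phi A^3\overline B$, $\phi A^3\overline B^3$ is trivial. Put $$S=\sum_{\substack{\chi\in\widehat{\mathbb F_q^\times}\\ \chi^3=\overline A^3}}\frac{g(\overline\chi)\,g(\phi\overline{B\chi})\,g(B\overline{A^3\chi})}{g(\phi\overline B)\,g(\overline A^3B)\,g(A^3)}\,\overline\chi(-4).$$ Then for every $x\in\mathbb F_q$ $$\overline A^3(1-x)\;{}_3\mathbb F_2\left[\begin{matrix}A&A\eta&A\overline\eta\\&\phi B&A^3\overline B\end{matrix};\frac{27x^2}{4(1-x)^3}\right]={}_3\mathbb F_2\left[\begin{matrix}A^3&B&\phi A^3\overline B\\&B^2&A^6\overline B^2\end{matrix};4x\right]-\delta(x+2)\frac{g(\phi)g(\overline A^3)}{g(\phi\overline B)g(\overline A^3B)}-\delta(1-x)\,S,$$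 where for $x=1$ the left-hand side is understood to be $0$. In particular, $${}_3\mathbb F_2\left[\begin{matrix}A^3&B&\phi A^3\overline B\\&B^2&A^6\overline B^2\end{matrix};4\right]=S.$$ -/

import Mathlib

/-- `δ(x)` is `1` if `x = 0` and `0` otherwise. -/
noncomputable def ffDelta {F : Type*} [Field F] [DecidableEq F] (x : F) : ℂ :=
  if x = 0 then 1 else 0

/-- The quadratic character `φ` of a finite field, with complex values. -/
noncomputable def phiChar (F : Type*) [Field F] [Fintype F] [DecidableEq F] : MulChar F ℂ :=
  (quadraticChar F).ringHomComp (Int.castRingHom ℂ)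

/-- The additive character `x ↦ ζ ^ Tr(x)` of a finite field `F` of characteristic `p`, where
`ζ` is a primitive `p`-th root of unity and `Tr` is the trace to the prime field. -/
noncomputable def traceChar (p : ℕ) [Fact p.Prime] (F : Type*) [Field F] [Fintype F]
    [Algebra (ZMod p) F] {ζ : ℂ} (hζ : IsPrimitiveRoot ζ p) : AddChar F ℂ :=
  (AddChar.zmodChar p hζ.pow_eq_one).compAddMonoidHom (Algebra.trace (ZMod p) F).toAddMonoidHom

theorem traceChar_apply (p : ℕ) [Fact p.Prime] (F : Type*) [Field F] [Fintype F]
    [Algebra (ZMod p) F] {ζ : ℂ} (hζ : IsPrimitiveRoot ζ p) (x : F) :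
    traceChar p F hζ x = ζ ^ (Algebra.trace (ZMod p) F x).val := rfl

/-- The period function `ₙ₊₁ℙₙ[A₀, …, Aₙ; B₀, …, Bₙ₋₁; t]` over the finite field `F`, by
recursion on `n` (integrating out the last pair of parameters). Multiplicative characters are
extended by `χ(0) = 0`, also for the trivial character; `A⁻¹` is the complex conjugate of `A`. -/
noncomputable def hypP {F : Type*} [Field F] [Fintype F] :
    (n : ℕ) → (Fin (n + 1) → MulChar F ℂ) → (Fin n → MulChar F ℂ) → F → ℂ
  | 0, A, _, t => (A 0)⁻¹ (1 - t)
  | n + 1, A, B, t =>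
      ∑ y : F, A (Fin.last (n + 1)) y * ((A (Fin.last (n + 1)))⁻¹ * B (Fin.last n)) (1 - y) *
        hypP n (fun i => A i.castSucc) (fun i => B i.castSucc) (t * y)

/-- The normalized hypergeometric function `ₙ₊₁𝔽ₙ` over the finite field `F`: the period function
divided by the product of the Jacobi sums of the pairs `(Aᵢ₊₁, Bᵢ Aᵢ₊₁⁻¹)`. -/
noncomputable def hypF {F : Type*} [Field F] [Fintype F] (n : ℕ)
    (A : Fin (n + 1) → MulChar F ℂ) (B : Fin n → MulChar F ℂ) (t : F) : ℂ :=
  1 / (∏ i : Fin n, jacobiSum (A i.succ) (B i * (A i.succ)⁻¹)) * hypP n A B t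

/-- The sum over all characters `χ` with `χ³ = A⁻³` of
`g(χ⁻¹) g(φ B⁻¹ χ⁻¹) g(B A⁻³ χ⁻¹) / (g(φ B⁻¹) g(A⁻³ B) g(A³)) · χ⁻¹(-4)`,
with Gauss sums `g` formed with the additive character `ψ`. -/
noncomputable def cubicGaussTerm {F : Type*} [Field F] [Fintype F] [DecidableEq F]
    (ψ : AddChar F ℂ) (A B : MulChar F ℂ) : ℂ :=
  ∑ χ ∈ (Set.toFinite {χ : MulChar F ℂ | χ ^ 3 = (A⁻¹) ^ 3}).toFinset,
    gaussSum χ⁻¹ ψ * gaussSum (phiChar F * (B * χ)⁻¹) ψ * gaussSum (B * (A ^ 3 * χ)⁻¹) ψ /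
      (gaussSum (phiChar F * B⁻¹) ψ * gaussSum ((A⁻¹) ^ 3 * B) ψ * gaussSum (A ^ 3) ψ) *
      χ⁻¹ (-4)

/-! For `x ≠ 0, 1` both sides reduce to one exponential sum. With `ψ` the additive character, `D =
A³`, `V = φB̄`, `W = Ā³B`, put `L(x) = ∑ D(s) V(v) W(w) ψ(s(1-x) + v + w - x²s³/(4vw))`, which is
`cubicExpSum`. Up to the delta term, each side equals `L(x) / (g(V) g(W) g(D))`.

Right side. With `C = φA³B̄` the upper parameters are `φBC, B, C` and the lower ones `B², C²`.
Expanding character values into additive characters (`gaussSum_mul_hypP_eq`) leaves sums over `y`,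
`z` of `ψ` at a quadratic polynomial. Completing the square twice gives `φ` of a discriminant
polynomial in two dual variables `α, β`. The same double sum of `φ` values is `L(x)` after `v =
sα/4`, `w = sβ/4` (`cubicExpSum_eq`). The quadratic form degenerates on `αβ = 4x²`; the resulting
errors cancel by orthogonality of characters, except for one contribution at `α = β = 2x`, present
only when `x = -2`. This is the delta term (`sum_inv_mul_periodKernel`).

Left side. The same expansion leaves the variables `s, y, z` with twists `A, Aη, Aη̄`, where the
argument multiplies only the product `syz`. Grouping by that product produces a twisted Kloosterman
sum, which equals `q` times the sum of `ψ` over the cube roots of `27w` (`cubicKloosterman_eq`, an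
additive form of Hasse–Davenport). Thus `syz` becomes `s³/27`, and the argument `27x²/(4(1-x)³)` is
exactly what turns the result into `L(x)`. The Kloosterman identity is proved in mean square: the
two norms and the inner product are computed, the last by counting points on a nodal cubic, and the
squared distance is zero.

At `x = 1` the linear term in `s` disappears, the summand depends on `s³` only, and `L(1)` splits
into three products of Gauss sums, which form `S`. At `x = 0` both hypergeometric values are `1`. -/

/-! ### Values of multiplicative characters -/

section CharacterValues

variable {F : Type*} [Field F]

theorem MulChar.inv_apply_mul_apply (χ : MulChar F ℂ) {x : F} (hx : x ≠ 0) : χ⁻¹ x * χ x = 1 := by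
  rw [← MulChar.mul_apply, MulChar.inv_mul, MulChar.one_apply hx.isUnit]

theorem MulChar.apply_mul_inv_apply (χ : MulChar F ℂ) {x : F} (hx : x ≠ 0) : χ x * χ⁻¹ x = 1 := by
  rw [mul_comm, χ.inv_apply_mul_apply hx]

theorem MulChar.neg_one_mul_self (χ : MulChar F ℂ) : χ (-1) * χ (-1) = 1 := by
  rw [← map_mul]; simp

theorem MulChar.inv_neg_one (χ : MulChar F ℂ) : χ⁻¹ (-1) = χ (-1) := by
  rw [MulChar.inv_apply', _root_.inv_neg_one]

theorem MulChar.apply_div (A : MulChar F ℂ) (a b : F) : A (a / b) = A a * A⁻¹ b := by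
  rw [div_eq_mul_inv, map_mul, ← MulChar.inv_apply']

end CharacterValues

/-! ### Gauss and Jacobi sums -/

section CharacterSums

variable {F : Type*} [Field F] [Fintype F]

theorem sum_mul_left_comp {c : F} (hc : c ≠ 0) (f : F → ℂ) : ∑ y, f (c * y) = ∑ y, f y :=
  Equiv.sum_comp (Equiv.mulLeft₀ c hc) f

theorem card_cast_ne_zero : (Fintype.card F : ℂ) ≠ 0 := by
  exact_mod_cast Fintype.card_ne_zero

variable {ψ : AddChar F ℂ}

theorem sum_addChar_mul [DecidableEq F] (hψ : ψ.IsPrimitive) (a : F) :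
    ∑ y, ψ (a * y) = if a = 0 then (Fintype.card F : ℂ) else 0 := by
  have := AddChar.sum_mulShift a hψ
  simp only [mul_comm a]
  simpa using this

theorem sum_ne_zero_addChar_mul [DecidableEq F] (hψ : ψ.IsPrimitive) (a : F) :
    ∑ y, (if y = 0 then 0 else ψ (a * y)) = (if a = 0 then (Fintype.card F : ℂ) else 0) - 1 := by
  rw [← sum_addChar_mul hψ, eq_sub_iff_add_eq]
  have : (1 : ℂ) = ∑ y : F, if y = 0 then ψ (a * y) else 0 := by
    simp
  rw [this, ← Finset.sum_add_distrib]
  refine Finset.sum_congr rfl fun y _ => ?_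
  split_ifs <;> simp

/-- The basic expansion tool. Nontriviality of `χ` makes it valid at `u = 0` as well, so it can be
inserted in a sum without splitting off zeros. -/
theorem sum_mulChar_mul_addChar {χ : MulChar F ℂ} (hχ : χ ≠ 1) (u : F) :
    ∑ s, χ s * ψ (s * u) = χ⁻¹ u * gaussSum χ ψ := by
  rcases eq_or_ne u 0 with rfl | hu
  · simp [MulChar.sum_eq_zero_of_ne_one hχ, MulChar.map_zero]
  · have := gaussSum_mulShift_eq χ ψ (Units.mk0 u hu)
    simp only [gaussSum, AddChar.mulShift_apply, Units.val_mk0] at this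
    rw [gaussSum, ← this]
    exact Finset.sum_congr rfl fun s _ => by rw [mul_comm s]

theorem gaussSum_mul_gaussSum_inv (hψ : ψ.IsPrimitive) {χ : MulChar F ℂ} (hχ : χ ≠ 1) :
    gaussSum χ ψ * gaussSum χ⁻¹ ψ = χ (-1) * Fintype.card F := by
  rw [← mul_gaussSum_inv_eq_gaussSum χ⁻¹ ψ, mul_left_comm, gaussSum_mul_gaussSum_eq_card hχ hψ,
    MulChar.inv_neg_one]

theorem gaussSum_ne_zero (hψ : ψ.IsPrimitive) (χ : MulChar F ℂ) : gaussSum χ ψ ≠ 0 := by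
  by_cases h : χ = 1
  · have : ψ ≠ 1 := fun h1 => hψ one_ne_zero (by rw [h1]; ext; simp)
    rw [h, gaussSum_one_left this]; simp
  · exact gaussSum_ne_zero_of_nontrivial card_cast_ne_zero h hψ

/-- Using `g((αβ)⁻¹)` as a factor instead of dividing by `g(αβ)` makes one formula cover `αβ = 1`
too, where `J(α, ᾱ) = -α(-1)` and `g(ε) = -1`. -/
theorem jacobiSum_mul_card (hψ : ψ.IsPrimitive) {α : MulChar F ℂ} (hα : α ≠ 1)
    (β : MulChar F ℂ) :
    jacobiSum α β * Fintype.card F =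
      gaussSum α ψ * gaussSum β ψ * gaussSum (α * β)⁻¹ ψ * (α * β) (-1) := by
  by_cases h : α * β = 1
  · have hβ' : β = α⁻¹ := by rw [eq_inv_iff_mul_eq_one, mul_comm, h]
    have : ψ ≠ 1 := fun h1 => hψ one_ne_zero (by rw [h1]; ext; simp)
    rw [h, hβ', jacobiSum_nontrivial_inv hα, gaussSum_mul_gaussSum_inv hψ hα, inv_one,
      gaussSum_one_left this, MulChar.one_apply (by simp)]
    ring
  · rw [mul_assoc, mul_comm (gaussSum α ψ), mul_comm (gaussSum β ψ)]
    have := jacobiSum_mul_nontrivial h ψ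
    have h2 := gaussSum_mul_gaussSum_inv hψ h
    have h3 := MulChar.neg_one_mul_self (α * β)
    linear_combination (gaussSum (α * β)⁻¹ ψ * (α * β) (-1)) * this -
      jacobiSum α β * (α * β) (-1) * h2 - jacobiSum α β * Fintype.card F * h3

theorem jacobiSum_ne_zero (hq : 2 < Fintype.card F) (hψ : ψ.IsPrimitive) (α β : MulChar F ℂ) :
    jacobiSum α β ≠ 0 := by
  by_cases hα : α = 1
  · by_cases hβ : β = 1
    · rw [hα, hβ, jacobiSum_one_one, sub_ne_zero]
      exact_mod_cast hq.ne'
    · rw [hα, jacobiSum_one_nontrivial hβ]; simp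
  · intro h
    have := jacobiSum_mul_card hψ hα β
    rw [h, zero_mul] at this
    have hu : (α * β) (-1) ≠ 0 := MulChar.apply_ne_zero_iff.2 (by simp)
    exact mul_ne_zero (mul_ne_zero (mul_ne_zero (gaussSum_ne_zero hψ _) (gaussSum_ne_zero hψ _))
      (gaussSum_ne_zero hψ _)) hu this.symm

theorem gaussSum_mul_jacobiSum (hψ : ψ.IsPrimitive) {α V : MulChar F ℂ} (hα : α ≠ 1)
    (hV : V⁻¹ * α ≠ 1) :
    gaussSum (V⁻¹ * α) ψ * jacobiSum α (V * α⁻¹) =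
      gaussSum α ψ * gaussSum V⁻¹ ψ * α (-1) := by
  have h1 := jacobiSum_mul_card hψ hα (V * α⁻¹)
  have h2 := gaussSum_mul_gaussSum_inv hψ hV
  rw [mul_inv, inv_inv] at h2
  rw [mul_comm V, mul_inv_cancel_left, mul_comm _ V] at h1
  rw [MulChar.mul_apply, MulChar.inv_neg_one] at h2
  apply mul_left_cancel₀ (card_cast_ne_zero (F := F))
  linear_combination gaussSum (V⁻¹ * α) ψ * h1 + gaussSum α ψ * gaussSum V⁻¹ ψ * V (-1) * h2 +
    gaussSum α ψ * gaussSum V⁻¹ ψ * α (-1) * Fintype.card F * V.neg_one_mul_self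

end CharacterSums

/-! ### The quadratic character and quadratic Gauss sums -/

section QuadraticCharacter

variable {F : Type*} [Field F] [Fintype F] [DecidableEq F]

theorem ringChar_ne_two {F : Type*} [Field F] (h2 : (2 : F) ≠ 0) : ringChar F ≠ 2 := by
  intro h
  have := ringChar.Nat.cast_ringChar (R := F)
  rw [h] at this
  exact h2 (by exact_mod_cast this)

theorem phiChar_isQuadratic : (phiChar F).IsQuadratic :=
  quadraticChar_isQuadratic F |>.comp _

theorem phiChar_inv : (phiChar F)⁻¹ = phiChar F := phiChar_isQuadratic.inv

theorem phiChar_mul_self : phiChar F * phiChar F = 1 := by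
  rw [← sq, phiChar_isQuadratic.sq_eq_one]

theorem phiChar_apply_mul_self {x : F} (hx : x ≠ 0) : phiChar F x * phiChar F x = 1 := by
  rw [← MulChar.mul_apply, phiChar_mul_self, MulChar.one_apply hx.isUnit]

theorem phiChar_inv_apply (x : F) : phiChar F x⁻¹ = phiChar F x := by
  rw [← MulChar.inv_apply', phiChar_inv]

theorem phiChar_ne_one (h2 : (2 : F) ≠ 0) : phiChar F ≠ 1 :=
  (MulChar.ringHomComp_ne_one_iff (RingHom.injective_int _)).2
    (quadraticChar_ne_one (ringChar_ne_two h2))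

theorem phiChar_div_apply {x y : F} : phiChar F (x / y) = phiChar F x * phiChar F y := by
  rw [div_eq_mul_inv, map_mul, phiChar_inv_apply]

theorem phiChar_four (h2 : (2 : F) ≠ 0) : phiChar F 4 = 1 := by
  rw [show (4 : F) = 2 * 2 by norm_num, map_mul, phiChar_apply_mul_self h2]

theorem sum_comp_sq (h2 : (2 : F) ≠ 0) (f : F → ℂ) :
    ∑ w : F, f (w ^ 2) = ∑ v : F, (1 + phiChar F v) * f v := by
  have hF := ringChar_ne_two h2
  have h := Finset.sum_fiberwise (s := (Finset.univ : Finset F)) (g := fun w : F => w ^ 2)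
    (f := fun w : F => f (w ^ 2))
  rw [← h]
  refine Finset.sum_congr rfl fun v _ => ?_
  have h1 : ∀ w ∈ Finset.univ.filter (fun w : F => w ^ 2 = v), f (w ^ 2) = f v := by
    intro w hw; rw [(Finset.mem_filter.1 hw).2]
  rw [Finset.sum_congr rfl h1, Finset.sum_const, nsmul_eq_mul]
  congr 1
  have h3 := quadraticChar_card_sqrts hF v
  have h4 : (Finset.univ.filter (fun w : F => w ^ 2 = v)) = {x : F | x ^ 2 = v}.toFinset := by
    ext; simp
  rw [h4]
  have : (({x : F | x ^ 2 = v}.toFinset.card : ℤ) : ℂ) = ((quadraticChar F v + 1 : ℤ) : ℂ) := by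
    rw [h3]
  push_cast at this
  rw [this, phiChar]
  simp [MulChar.ringHomComp, add_comm]

variable {ψ : AddChar F ℂ}

theorem gaussSum_phiChar_sq (hψ : ψ.IsPrimitive) (h2 : (2 : F) ≠ 0) :
    gaussSum (phiChar F) ψ ^ 2 = phiChar F (-1) * Fintype.card F :=
  gaussSum_sq (phiChar_ne_one h2) phiChar_isQuadratic hψ

theorem sum_addChar_quadratic (hψ : ψ.IsPrimitive) (h2 : (2 : F) ≠ 0) {a : F} (ha : a ≠ 0)
    (b : F) :
    ∑ y, ψ (a * y ^ 2 + b * y) =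
      phiChar F a * gaussSum (phiChar F) ψ * ψ (-(b ^ 2) / (4 * a)) := by
  have h4 : (4 : F) ≠ 0 := by
    rw [show (4 : F) = 2 * 2 by norm_num]; exact mul_ne_zero h2 h2
  have h1 : ∑ y, ψ (a * y ^ 2 + b * y) = ∑ y, ψ (a * y ^ 2) * ψ (-(b ^ 2) / (4 * a)) := by
    rw [← Equiv.sum_comp (Equiv.subRight (b / (2 * a)))]
    refine Finset.sum_congr rfl fun y _ => ?_
    rw [← AddChar.map_add_eq_mul]
    congr 1
    simp only [Equiv.subRight_apply]
    field_simp
    ring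
  rw [h1, ← Finset.sum_mul, sum_comp_sq h2 (fun v => ψ (a * v))]
  congr 1
  simp only [add_mul, one_mul, Finset.sum_add_distrib]
  rw [sum_addChar_mul hψ, if_neg ha, zero_add]
  have := sum_mulChar_mul_addChar (ψ := ψ) (phiChar_ne_one h2) a
  rw [phiChar_inv] at this
  rw [← this]
  exact Finset.sum_congr rfl fun s _ => by rw [mul_comm s]

/-- Substituting `y = (1 + w)/2` turns `y(1 - y)` into `(1 - w²)/4`; then `w²` is replaced by `v`
with weight `1 + φ(v)`, and the unweighted part vanishes. -/
theorem jacobiSum_self (h2 : (2 : F) ≠ 0) {B : MulChar F ℂ} (hB : B ≠ 1) :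
    jacobiSum B B = B⁻¹ 4 * jacobiSum B (phiChar F) := by
  have h4 : (4 : F) ≠ 0 := by
    rw [show (4 : F) = 2 * 2 by norm_num]; exact mul_ne_zero h2 h2
  have h1 : jacobiSum B B = ∑ w : F, B⁻¹ 4 * B (1 - w ^ 2) := by
    rw [jacobiSum, ← sum_mul_left_comp (inv_ne_zero h2),
      ← Equiv.sum_comp (Equiv.addLeft (1 : F))]
    refine Finset.sum_congr rfl fun y _ => ?_
    rw [MulChar.inv_apply', ← map_mul, ← map_mul]
    congr 1
    simp only [Equiv.coe_addLeft]
    field_simp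
    ring
  rw [h1, ← Finset.mul_sum, sum_comp_sq h2 (fun v => B (1 - v)), jacobiSum_comm, jacobiSum]
  congr 1
  simp only [add_mul, one_mul, Finset.sum_add_distrib]
  have : ∑ v : F, B (1 - v) = 0 := by
    rw [← MulChar.sum_eq_zero_of_ne_one hB]
    exact Equiv.sum_comp (Equiv.subLeft (1 : F)) B
  rw [this, zero_add]

end QuadraticCharacter

/-! ### The period kernel and the common exponential sum -/

section Kernel

variable {F : Type*} [Field F] [Fintype F] [DecidableEq F] {ψ : AddChar F ℂ}

theorem sum_addChar_quadratic_add (hψ : ψ.IsPrimitive) (h2 : (2 : F) ≠ 0) {a : F} (ha : a ≠ 0)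
    (b c : F) :
    ∑ y, ψ (a * y ^ 2 + b * y + c) =
      phiChar F a * gaussSum (phiChar F) ψ * ψ (c - b ^ 2 / (4 * a)) := by
  simp only [AddChar.map_add_eq_mul ψ _ c]
  rw [← Finset.sum_mul, sum_addChar_quadratic hψ h2 ha, mul_assoc, ← AddChar.map_add_eq_mul]
  congr 2
  ring

/-- The sum over `s`, `y`, `z` obtained from the period integral on writing every character value
as a Gauss sum; `α` and `β` are the dual variables. -/
noncomputable def periodKernel (ψ : AddChar F ℂ) (x α β : F) : ℂ :=
  ∑ s, phiChar F s * ∑ z, ∑ y,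
    ψ (s * (1 - 4 * x * y * z + α * y * (1 - y) + β * z * (1 - z)))

/-- The discriminant polynomial of the period kernel. -/
def kernelPoly (x α β : F) : F := α * β * (4 - 4 * x + α + β) - 16 * x ^ 2

theorem four_ne_zero_of_two {K : Type*} [Field K] (h2 : (2 : K) ≠ 0) : (4 : K) ≠ 0 := by
  rw [show (4 : K) = 2 * 2 by norm_num]
  exact mul_ne_zero h2 h2

theorem sum_sum_addChar_eq (hψ : ψ.IsPrimitive) (h2 : (2 : F) ≠ 0) {s α : F} (hs : s ≠ 0)
    (hα : α ≠ 0) (x β : F) :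
    ∑ z, ∑ y, ψ (s * (1 - 4 * x * y * z + α * y * (1 - y) + β * z * (1 - z))) =
      phiChar F (-(s * α)) * gaussSum (phiChar F) ψ *
        ∑ z, ψ (s * (4 * x ^ 2 / α - β) * z ^ 2 + s * (β - 2 * x) * z + s * (1 + α / 4)) := by
  have h4 := four_ne_zero_of_two h2
  rw [Finset.mul_sum]
  refine Finset.sum_congr rfl fun z _ => ?_
  have := sum_addChar_quadratic_add hψ h2 (neg_ne_zero.2 (mul_ne_zero hs hα))
    (s * (α - 4 * x * z)) (s * (1 + β * z * (1 - z)))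
  rw [show s * (4 * x ^ 2 / α - β) * z ^ 2 + s * (β - 2 * x) * z + s * (1 + α / 4) =
    s * (1 + β * z * (1 - z)) - (s * (α - 4 * x * z)) ^ 2 / (4 * -(s * α)) by
      field_simp; ring, ← this]
  refine Finset.sum_congr rfl fun y _ => ?_
  congr 1
  ring

/-- Each of the sums over `y`, `z` and `s` contributes a factor `g(φ)`. The product of the two
leading coefficients is `s²(αβ - 4x²)`, so the `φ(s)` already present survives and turns the sum
over `s` into a Gauss sum. The remaining constant is `kernelPoly` divided by `4(αβ - 4x²)`. -/
theorem periodKernel_eq_of_ne (hψ : ψ.IsPrimitive) (h2 : (2 : F) ≠ 0) {x α β : F}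
    (hα : α ≠ 0) (h : α * β ≠ 4 * x ^ 2) :
    periodKernel ψ x α β = gaussSum (phiChar F) ψ ^ 3 * phiChar F (kernelPoly x α β) := by
  have h4 := four_ne_zero_of_two h2
  have hΔ : α * β - 4 * x ^ 2 ≠ 0 := sub_ne_zero.2 h
  have hβ : 4 * x ^ 2 / α - β ≠ 0 := by
    intro h0
    apply h
    field_simp at h0
    linear_combination -h0
  have key : ∀ s : F, phiChar F s * ∑ z, ∑ y,
      ψ (s * (1 - 4 * x * y * z + α * y * (1 - y) + β * z * (1 - z))) =
      phiChar F (α * β - 4 * x ^ 2) * gaussSum (phiChar F) ψ ^ 2 *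
        (phiChar F s * ψ (s * (kernelPoly x α β / (4 * (α * β - 4 * x ^ 2))))) := by
    intro s
    rcases eq_or_ne s 0 with rfl | hs
    · simp [MulChar.map_zero]
    rw [sum_sum_addChar_eq hψ h2 hs hα, sum_addChar_quadratic_add hψ h2 (mul_ne_zero hs hβ)]
    have e1 : phiChar F (-(s * α)) * phiChar F (s * (4 * x ^ 2 / α - β)) =
        phiChar F (α * β - 4 * x ^ 2) := by
      rw [← map_mul, show -(s * α) * (s * (4 * x ^ 2 / α - β)) =
        s * s * (α * β - 4 * x ^ 2) by field_simp; ring, map_mul, map_mul,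
        phiChar_apply_mul_self hs, one_mul]
    have e2 : s * (1 + α / 4) - (s * (β - 2 * x)) ^ 2 / (4 * (s * (4 * x ^ 2 / α - β))) =
        s * (kernelPoly x α β / (4 * (α * β - 4 * x ^ 2))) := by
      rw [show 4 * x ^ 2 / α - β = -(α * β - 4 * x ^ 2) / α by field_simp; ring]
      generalize hd : α * β - 4 * x ^ 2 = d at hΔ ⊢
      field_simp
      rw [kernelPoly]
      linear_combination (-(4 + α)) * hd
    rw [e2, ← e1]
    ring
  rw [periodKernel, Finset.sum_congr rfl fun s _ => key s, ← Finset.mul_sum,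
    sum_mulChar_mul_addChar (phiChar_ne_one h2), phiChar_inv, phiChar_div_apply, map_mul (phiChar F) 4,
    phiChar_four h2]
  linear_combination (gaussSum (phiChar F) ψ ^ 3 * phiChar F (kernelPoly x α β)) *
    phiChar_apply_mul_self hΔ

/-- Here the quadratic term in `z` vanishes. The remaining linear sum over `z` is zero unless its
coefficient `s(β - 2x)` is, which on this locus means `α = 2x`; what is left is a sum over `s ≠ 0`
of an additive character that is trivial exactly for `x = -2`. -/
theorem periodKernel_eq_of_eq (hψ : ψ.IsPrimitive) (h2 : (2 : F) ≠ 0) {x α β : F}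
    (hx : x ≠ 0) (hα : α ≠ 0) (h : α * β = 4 * x ^ 2) :
    periodKernel ψ x α β = if α = 2 * x then phiChar F (-α) * gaussSum (phiChar F) ψ *
      Fintype.card F * (ffDelta (x + 2) * Fintype.card F - 1) else 0 := by
  have h4 := four_ne_zero_of_two h2
  have hβ : 4 * x ^ 2 / α - β = 0 := by
    field_simp
    linear_combination -h
  have hiff : β - 2 * x = 0 ↔ α = 2 * x := by
    constructor
    · intro h0
      have : 2 * x * (α - 2 * x) = 0 := by linear_combination h - α * h0
      rcases mul_eq_zero.1 this with h5 | h5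
      · exact absurd h5 (mul_ne_zero h2 hx)
      · exact sub_eq_zero.1 h5
    · intro h0
      have : 2 * x * (β - 2 * x) = 0 := by rw [h0] at h; linear_combination h
      exact (mul_eq_zero.1 this).resolve_left (mul_ne_zero h2 hx)
  have key : ∀ s : F, phiChar F s * ∑ z, ∑ y,
      ψ (s * (1 - 4 * x * y * z + α * y * (1 - y) + β * z * (1 - z))) =
      if α = 2 * x then phiChar F (-α) * gaussSum (phiChar F) ψ * Fintype.card F *
        (if s = 0 then 0 else ψ ((1 + α / 4) * s)) else 0 := by
    intro s
    rcases eq_or_ne s 0 with rfl | hs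
    · simp [MulChar.map_zero]
    rw [sum_sum_addChar_eq hψ h2 hs hα, hβ, if_neg hs]
    simp only [mul_zero, zero_mul, zero_add, AddChar.map_add_eq_mul]
    rw [← Finset.sum_mul, sum_addChar_mul hψ]
    simp only [mul_eq_zero, hs, false_or, hiff]
    split_ifs
    · rw [show -(s * α) = s * (-α) by ring, map_mul, mul_comm s (1 + α / 4)]
      linear_combination (phiChar F (-α) * gaussSum (phiChar F) ψ * Fintype.card F *
        ψ ((1 + α / 4) * s)) * phiChar_apply_mul_self hs
    · simp
  rw [periodKernel, Finset.sum_congr rfl fun s _ => key s]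
  split_ifs with h5
  · rw [← Finset.mul_sum, sum_ne_zero_addChar_mul hψ]
    congr 1
    have : 1 + α / 4 = 0 ↔ x + 2 = 0 := by
      rw [h5]
      constructor
      · intro h0
        field_simp at h0
        have : 2 * (x + 2) = 0 := by linear_combination h0
        exact (mul_eq_zero.1 this).resolve_left h2
      · intro h0
        field_simp
        linear_combination 2 * h0
    simp only [this, ffDelta]
    split_ifs <;> simp
  · simp

/-- On this locus the polynomial is `(2x(α - 2x))² / α`. -/
theorem phiChar_kernelPoly_of_eq (h2 : (2 : F) ≠ 0) {x α β : F}
    (hx : x ≠ 0) (hα : α ≠ 0) (h : α * β = 4 * x ^ 2) :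
    phiChar F (kernelPoly x α β) = if α = 2 * x then 0 else phiChar F α := by
  have hβ : β = 4 * x ^ 2 / α := by field_simp; linear_combination h
  have e : kernelPoly x α β = (2 * x * (α - 2 * x)) * (2 * x * (α - 2 * x)) / α := by
    rw [kernelPoly, hβ]
    field_simp
    ring
  rw [e, phiChar_div_apply, map_mul]
  split_ifs with h5
  · simp [h5, MulChar.map_zero]
  · rw [phiChar_apply_mul_self (mul_ne_zero (mul_ne_zero h2 hx) (sub_ne_zero.2 h5)), one_mul]

theorem sum_inv_mul_periodKernel (hψ : ψ.IsPrimitive) (h2 : (2 : F) ≠ 0) {x : F} (hx : x ≠ 0)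
    {B C : MulChar F ℂ} (hBC : phiChar F * B⁻¹ * C ≠ 1) :
    ∑ α, ∑ β, B⁻¹ α * C⁻¹ β * periodKernel ψ x α β =
      gaussSum (phiChar F) ψ ^ 3 *
        ∑ α, ∑ β, B⁻¹ α * C⁻¹ β * phiChar F (kernelPoly x α β) +
      ffDelta (x + 2) * ((phiChar F * B * C)⁻¹ (-4) * phiChar F (-1) * gaussSum (phiChar F) ψ *
        Fintype.card F ^ 2) := by
  have h4 := four_ne_zero_of_two h2
  set g := gaussSum (phiChar F) ψ with hg
  have hg3 : g ^ 3 = phiChar F (-1) * Fintype.card F * g := by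
    rw [pow_succ, hg, gaussSum_phiChar_sq hψ h2]
  -- For `α ≠ 0` only `β = 4x²/α` deviates from the generic formula. Since `g(φ)³ = φ(-1) q g(φ)`,
  -- the deviation is a multiple of `(φB̄C)(α)` uniformly in `α`, the value `α = 2x` included; only
  -- the delta part at `α = 2x` is extra. The uniform part then sums to zero because `φB̄C` is
  -- nontrivial.
  have row : ∀ α, ∑ β, B⁻¹ α * C⁻¹ β * periodKernel ψ x α β =
      g ^ 3 * ∑ β, B⁻¹ α * C⁻¹ β * phiChar F (kernelPoly x α β) +
      ((if α = 2 * x then ffDelta (x + 2) * ((phiChar F * B * C)⁻¹ (2 * x) * phiChar F (-1) * g *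
        Fintype.card F ^ 2) else 0) -
        g ^ 3 * C⁻¹ (4 * x ^ 2) * (phiChar F * B⁻¹ * C) α) := by
    intro α
    rcases eq_or_ne α 0 with rfl | hα
    · have : (0 : F) ≠ 2 * x := (mul_ne_zero h2 hx).symm
      simp [MulChar.map_zero, this]
    have hb0 : α * (4 * x ^ 2 / α) = 4 * x ^ 2 := by field_simp
    rw [Finset.mul_sum, ← sub_eq_iff_eq_add', ← Finset.sum_sub_distrib,
      Finset.sum_eq_single (4 * x ^ 2 / α)]
    · rw [periodKernel_eq_of_eq hψ h2 hx hα hb0, phiChar_kernelPoly_of_eq h2 hx hα hb0]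
      have hC : C⁻¹ (4 * x ^ 2 / α) = C⁻¹ (4 * x ^ 2) * C α := by
        rw [div_eq_mul_inv, map_mul, ← MulChar.inv_apply' C⁻¹, inv_inv]
      rw [hC]
      split_ifs with h5
      · have e1 : C⁻¹ (4 * x ^ 2) * C α = C⁻¹ α := by
          rw [show 4 * x ^ 2 = α * α by rw [h5]; ring, map_mul, mul_assoc, C.inv_apply_mul_apply hα,
            mul_one]
        rw [← h5, mul_inv, mul_inv, phiChar_inv, ← hg]
        simp only [MulChar.mul_apply]
        have hneg : phiChar F (-α) = phiChar F (-1) * phiChar F α := by rw [← map_mul, neg_one_mul]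
        rw [hneg]
        linear_combination (B⁻¹ α * phiChar F α * (phiChar F (-1) * g * Fintype.card F *
          (ffDelta (x + 2) * Fintype.card F - 1) + g ^ 3)) * e1 +
          (B⁻¹ α * phiChar F α * C⁻¹ α) * hg3
      · simp only [MulChar.mul_apply]
        ring
    · intro β _ hβ
      rw [periodKernel_eq_of_ne hψ h2 hα]
      · ring
      · intro h
        apply hβ
        field_simp
        linear_combination h
    · simp
  rw [Finset.sum_congr rfl fun α _ => row α, Finset.sum_add_distrib, ← Finset.mul_sum,
    Finset.sum_sub_distrib, ← Finset.mul_sum, MulChar.sum_eq_zero_of_ne_one hBC]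
  simp only [mul_zero, sub_zero, Finset.sum_ite_eq', Finset.mem_univ, if_true]
  congr 1
  unfold ffDelta
  split_ifs with h5
  · rw [show 2 * x = -4 by linear_combination 2 * h5]
  · simp

/-- The variable `s` comes from the factor `(φBC)⁻¹(1 - 4xyz)`, while `α` and `β` come from `B` and
`C` at `sy(1 - y)` and `sz(1 - z)`. Absorbing `B(s)C(s)` into these arguments leaves only `φ(s)`. -/
theorem gaussSum_mul_hypP_eq {x : F} {B C : MulChar F ℂ} (hB : B ≠ 1) (hC : C ≠ 1)
    (hD : phiChar F * B * C ≠ 1) :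
    gaussSum B⁻¹ ψ * gaussSum C⁻¹ ψ * gaussSum (phiChar F * B * C) ψ *
      hypP 2 ![phiChar F * B * C, B, C] ![B ^ 2, C ^ 2] (4 * x) =
      ∑ α, ∑ β, B⁻¹ α * C⁻¹ β * periodKernel ψ x α β := by
  have hP : hypP 2 ![phiChar F * B * C, B, C] ![B ^ 2, C ^ 2] (4 * x) =
      ∑ z, ∑ y, C z * C (1 - z) * (B y * B (1 - y)) *
        (phiChar F * B * C)⁻¹ (1 - 4 * x * z * y) := by
    have e (X : MulChar F ℂ) : X⁻¹ * X ^ 2 = X := by rw [sq, inv_mul_cancel_left]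
    simp only [hypP, Finset.mul_sum]
    refine Finset.sum_congr rfl fun z _ => Finset.sum_congr rfl fun y _ => ?_
    have l2 : Fin.last 2 = 2 := rfl
    have l1 : Fin.last 1 = 1 := rfl
    simp [e, l1, l2, mul_assoc]
  have hinv {X : MulChar F ℂ} (hX : X ≠ 1) (u : F) :
      gaussSum X⁻¹ ψ * X u = ∑ a, X⁻¹ a * ψ (a * u) := by
    rw [sum_mulChar_mul_addChar (inv_ne_one.2 hX), inv_inv, mul_comm]
  have key : ∀ z y, gaussSum B⁻¹ ψ * gaussSum C⁻¹ ψ * gaussSum (phiChar F * B * C) ψ *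
      (C z * C (1 - z) * (B y * B (1 - y)) * (phiChar F * B * C)⁻¹ (1 - 4 * x * z * y)) =
      ∑ s, ∑ a, ∑ b, B⁻¹ a * C⁻¹ b * (phiChar F s *
        ψ (s * (1 - 4 * x * y * z + a * y * (1 - y) + b * z * (1 - z)))) := by
    intro z y
    rw [show gaussSum B⁻¹ ψ * gaussSum C⁻¹ ψ * gaussSum (phiChar F * B * C) ψ *
      (C z * C (1 - z) * (B y * B (1 - y)) * (phiChar F * B * C)⁻¹ (1 - 4 * x * z * y)) =
      gaussSum B⁻¹ ψ * gaussSum C⁻¹ ψ * (C z * C (1 - z) * (B y * B (1 - y))) *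
      ((phiChar F * B * C)⁻¹ (1 - 4 * x * z * y) * gaussSum (phiChar F * B * C) ψ) by ring,
      ← sum_mulChar_mul_addChar hD, Finset.mul_sum]
    refine Finset.sum_congr rfl fun s _ => ?_
    have e1 := hinv hB (s * y * (1 - y))
    have e2 := hinv hC (s * z * (1 - z))
    simp only [MulChar.mul_apply, map_mul] at e1 e2 ⊢
    rw [show gaussSum B⁻¹ ψ * gaussSum C⁻¹ ψ * (C z * C (1 - z) * (B y * B (1 - y))) *
      (phiChar F s * B s * C s * ψ (s * (1 - 4 * x * z * y))) =
      (gaussSum B⁻¹ ψ * (B s * B y * B (1 - y))) * (gaussSum C⁻¹ ψ * (C s * C z * C (1 - z))) *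
      (phiChar F s * ψ (s * (1 - 4 * x * z * y))) by ring, e1, e2, Finset.sum_mul_sum,
      Finset.sum_mul]
    refine Finset.sum_congr rfl fun a _ => ?_
    rw [Finset.sum_mul]
    refine Finset.sum_congr rfl fun b _ => ?_
    rw [show s * (1 - 4 * x * y * z + a * y * (1 - y) + b * z * (1 - z)) =
      a * (s * y * (1 - y)) + b * (s * z * (1 - z)) + s * (1 - 4 * x * z * y) by ring,
      AddChar.map_add_eq_mul, AddChar.map_add_eq_mul]
    ring
  rw [hP, Finset.mul_sum]
  simp only [Finset.mul_sum, key, periodKernel]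
  simp only [← Fintype.sum_prod_type']
  let swap : F × F × F × F × F → F × F × F × F × F :=
    fun t => (t.2.2.2.1, t.2.2.2.2, t.2.2.1, t.1, t.2.1)
  have hswap : Function.Involutive swap := fun _ => rfl
  exact Fintype.sum_equiv hswap.toPerm _ _ fun _ => rfl

/-- The exponential sum through which both sides of the cubic transformation are expressed. -/
noncomputable def cubicExpSum (ψ : AddChar F ℂ) (D V W : MulChar F ℂ) (x : F) : ℂ :=
  ∑ s, ∑ v, ∑ w, D s * V v * W w *
    ψ (s * (1 - x) + v + w - x ^ 2 * s ^ 3 / (4 * v * w))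

theorem cubicExpSum_eq (h2 : (2 : F) ≠ 0) (x : F) (B C : MulChar F ℂ) :
    cubicExpSum ψ (phiChar F * B * C) (phiChar F * B⁻¹) (phiChar F * C⁻¹) x =
      gaussSum (phiChar F) ψ * (phiChar F * B * C) 4 *
        ∑ α, ∑ β, B⁻¹ α * C⁻¹ β * phiChar F (kernelPoly x α β) := by
  have h4 := four_ne_zero_of_two h2
  have hinv4 (X : MulChar F ℂ) (u v : F) : X⁻¹ (u / 4 * v) = X⁻¹ u * X 4 * X⁻¹ v := by
    rw [map_mul, div_eq_mul_inv, map_mul, ← MulChar.inv_apply' X⁻¹, inv_inv]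
  have row : ∀ s, ∑ v, ∑ w, (phiChar F * B * C) s * (phiChar F * B⁻¹) v * (phiChar F * C⁻¹) w *
      ψ (s * (1 - x) + v + w - x ^ 2 * s ^ 3 / (4 * v * w)) =
      ∑ α, ∑ β, (phiChar F * B * C) 4 * (B⁻¹ α * C⁻¹ β) * phiChar F (α * β) *
        (phiChar F s * ψ (s * (kernelPoly x α β / (4 * (α * β))))) := by
    intro s
    rcases eq_or_ne s 0 with rfl | hs
    · simp [MulChar.map_zero]
    -- The scaling `v = sα/4`, `w = sβ/4` makes the exponent linear in `s`, and the three characters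
    -- combine to `φ(s)`.
    have hs4 : s / 4 ≠ 0 := div_ne_zero hs h4
    rw [← sum_mul_left_comp hs4]
    refine Finset.sum_congr rfl fun α _ => ?_
    rw [← sum_mul_left_comp hs4]
    refine Finset.sum_congr rfl fun β _ => ?_
    rcases eq_or_ne α 0 with rfl | hα
    · simp [MulChar.map_zero]
    rcases eq_or_ne β 0 with rfl | hβ
    · simp [MulChar.map_zero]
    have e : s * (1 - x) + s / 4 * α + s / 4 * β -
        x ^ 2 * s ^ 3 / (4 * (s / 4 * α) * (s / 4 * β)) =
        s * (kernelPoly x α β / (4 * (α * β))) := by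
      rw [kernelPoly]
      field_simp
      ring
    rw [e]
    simp only [MulChar.mul_apply, hinv4]
    simp only [map_mul, phiChar_div_apply, phiChar_four h2]
    linear_combination (B⁻¹ α * C⁻¹ β * phiChar F α * phiChar F β * B 4 * C 4 *
      ψ (s * (kernelPoly x α β / (4 * (α * β)))) * phiChar F s) *
      ((phiChar F s * phiChar F s * (B s * B⁻¹ s)) * (C.apply_mul_inv_apply hs) +
        (phiChar F s * phiChar F s) * (B.apply_mul_inv_apply hs) + phiChar_apply_mul_self hs)
  rw [cubicExpSum, Finset.sum_congr rfl fun s _ => row s, Finset.sum_comm, Finset.mul_sum]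
  refine Finset.sum_congr rfl fun α _ => ?_
  rw [Finset.sum_comm, Finset.mul_sum]
  refine Finset.sum_congr rfl fun β _ => ?_
  rw [← Finset.mul_sum, sum_mulChar_mul_addChar (phiChar_ne_one h2), phiChar_inv]
  rcases eq_or_ne α 0 with rfl | hα
  · simp [MulChar.map_zero]
  rcases eq_or_ne β 0 with rfl | hβ
  · simp [MulChar.map_zero]
  rw [phiChar_div_apply, map_mul _ 4, phiChar_four h2]
  linear_combination ((phiChar F * B * C) 4 * (B⁻¹ α * C⁻¹ β) * phiChar F (kernelPoly x α β) *
    gaussSum (phiChar F) ψ) * phiChar_apply_mul_self (mul_ne_zero hα hβ)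

end Kernel

/-! ### Evaluation of the right-hand side -/

section RightSide

variable {F : Type*} [Field F] [Fintype F] [DecidableEq F] {ψ : AddChar F ℂ}

/-- Converts the normalizing factors `J(B, B)` and `J(C, C)` into the Gauss sums of `φB̄` and `φC̄`
that normalize `L(x)`. -/
theorem gaussSum_inv_mul_jacobiSum_self (hψ : ψ.IsPrimitive) (h2 : (2 : F) ≠ 0)
    {B : MulChar F ℂ} (hB : B ≠ 1) :
    gaussSum B⁻¹ ψ * jacobiSum B B =
      B⁻¹ 4 * phiChar F (-1) * gaussSum (phiChar F) ψ * gaussSum (phiChar F * B⁻¹) ψ := by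
  have h := jacobiSum_mul_card hψ hB (phiChar F)
  rw [mul_inv, phiChar_inv, mul_comm B⁻¹, MulChar.mul_apply] at h
  have h' := gaussSum_mul_gaussSum_inv hψ hB
  rw [jacobiSum_self h2 hB]
  apply mul_left_cancel₀ (card_cast_ne_zero (F := F))
  linear_combination gaussSum B⁻¹ ψ * B⁻¹ 4 * h +
    B⁻¹ 4 * gaussSum (phiChar F) ψ * gaussSum (phiChar F * B⁻¹) ψ * B (-1) * phiChar F (-1) * h' +
    B⁻¹ 4 * gaussSum (phiChar F) ψ * gaussSum (phiChar F * B⁻¹) ψ * phiChar F (-1) *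
      Fintype.card F * B.neg_one_mul_self

theorem hypF_sq_eq (hψ : ψ.IsPrimitive) (h2 : (2 : F) ≠ 0) (hq : 2 < Fintype.card F)
    {x : F} (hx : x ≠ 0) {B C : MulChar F ℂ} (hB : B ≠ 1) (hC : C ≠ 1)
    (hD : phiChar F * B * C ≠ 1) (hBC : phiChar F * B⁻¹ * C ≠ 1) :
    hypF 2 ![phiChar F * B * C, B, C] ![B ^ 2, C ^ 2] (4 * x) =
      cubicExpSum ψ (phiChar F * B * C) (phiChar F * B⁻¹) (phiChar F * C⁻¹) x /
        (gaussSum (phiChar F * B⁻¹) ψ * gaussSum (phiChar F * C⁻¹) ψ *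
          gaussSum (phiChar F * B * C) ψ) +
      ffDelta (x + 2) * (gaussSum (phiChar F) ψ * gaussSum (phiChar F * B * C)⁻¹ ψ /
        (gaussSum (phiChar F * B⁻¹) ψ * gaussSum (phiChar F * C⁻¹) ψ)) := by
  have h4 := four_ne_zero_of_two h2
  have hP := gaussSum_mul_hypP_eq (ψ := ψ) (x := x) hB hC hD
  rw [sum_inv_mul_periodKernel hψ h2 hx hBC] at hP
  have hL := cubicExpSum_eq (ψ := ψ) h2 x B C
  have hJB := gaussSum_inv_mul_jacobiSum_self hψ h2 hB
  have hJC := gaussSum_inv_mul_jacobiSum_self hψ h2 hC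
  have hg := gaussSum_phiChar_sq hψ h2
  have hDD := gaussSum_mul_gaussSum_inv hψ hD
  have h1 := (phiChar F).neg_one_mul_self
  have hB4 := B.inv_apply_mul_apply h4
  have hC4 := C.inv_apply_mul_apply h4
  have hD4 : (phiChar F * B * C)⁻¹ (-4) = (phiChar F * B * C) (-1) * (B⁻¹ 4 * C⁻¹ 4) := by
    rw [show (-4 : F) = (-1) * 4 by ring, map_mul, MulChar.inv_neg_one, mul_inv, mul_inv,
      phiChar_inv]
    simp only [MulChar.mul_apply, phiChar_four h2, one_mul]
  have hD4' : (phiChar F * B * C) 4 = B 4 * C 4 := by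
    simp only [MulChar.mul_apply, phiChar_four h2, one_mul]
  rw [hD4] at hP
  rw [hD4'] at hL
  have e (X : MulChar F ℂ) : X ^ 2 * X⁻¹ = X := by rw [sq, mul_inv_cancel_right]
  have hF : hypF 2 ![phiChar F * B * C, B, C] ![B ^ 2, C ^ 2] (4 * x) =
      1 / (jacobiSum B B * jacobiSum C C) *
        hypP 2 ![phiChar F * B * C, B, C] ![B ^ 2, C ^ 2] (4 * x) := by
    simp [hypF, Fin.prod_univ_two, e]
  rw [hF]
  have nJB := jacobiSum_ne_zero hq hψ B B
  have nJC := jacobiSum_ne_zero hq hψ C C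
  have nV := gaussSum_ne_zero hψ (phiChar F * B⁻¹)
  have nW := gaussSum_ne_zero hψ (phiChar F * C⁻¹)
  have nD := gaussSum_ne_zero hψ (phiChar F * B * C)
  have nB := gaussSum_ne_zero hψ B⁻¹
  have nC := gaussSum_ne_zero hψ C⁻¹
  generalize hypP 2 ![phiChar F * B * C, B, C] ![B ^ 2, C ^ 2] (4 * x) = P at *
  generalize ∑ α, ∑ β, B⁻¹ α * C⁻¹ β * phiChar F (kernelPoly x α β) = S at *
  generalize jacobiSum B B = JB at *
  generalize jacobiSum C C = JC at *
  generalize gaussSum (phiChar F * B⁻¹) ψ = gV at *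
  generalize gaussSum (phiChar F * C⁻¹) ψ = gW at *
  generalize gaussSum (phiChar F * B * C) ψ = gD at *
  generalize gaussSum (phiChar F * B * C)⁻¹ ψ = gDi at *
  generalize gaussSum B⁻¹ ψ = gB at *
  generalize gaussSum C⁻¹ ψ = gC at *
  generalize (phiChar F * B * C) (-1) = d at *
  generalize gaussSum (phiChar F) ψ = g at *
  generalize phiChar F (-1) = f at *
  generalize (Fintype.card F : ℂ) = q at *
  rw [hL]
  have main : P * (gV * gW * gD) =
      JB * JC * (g * (B 4 * C 4) * S + ffDelta (x + 2) * g * gDi * gD) := by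
    apply mul_left_cancel₀ (mul_ne_zero nB nC)
    have hJ : gB * gC * (JB * JC) = B⁻¹ 4 * C⁻¹ 4 * g ^ 2 * gV * gW := by
      linear_combination gC * JC * hJB + B⁻¹ 4 * f * g * gV * hJC +
        B⁻¹ 4 * C⁻¹ 4 * g ^ 2 * gV * gW * h1
    have hg3 : g ^ 3 * gD * gDi = d * f * g * q ^ 2 := by
      linear_combination g * (gD * gDi) * hg + g * f * q * hDD
    linear_combination gV * gW * hP -
      (g * (B 4 * C 4) * S + ffDelta (x + 2) * g * gDi * gD) * hJ -
      (g ^ 3 * S * gV * gW) * (B⁻¹ 4 * B 4 * hC4 + hB4) -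
      gV * gW * ffDelta (x + 2) * B⁻¹ 4 * C⁻¹ 4 * hg3
  field_simp
  linear_combination main

end RightSide

/-! ### Sums over the unit group -/

section SumUnits

variable {F : Type*} [Field F] [Fintype F] [DecidableEq F]

theorem sum_eq_sum_units (f : F → ℂ) (h0 : f 0 = 0) : ∑ s, f s = ∑ u : Fˣ, f u := by
  rw [← Finset.sum_subset (Finset.subset_univ ({0}ᶜ : Finset F))
    (by intro x _ hx; simp at hx; rw [hx, h0]),
    Finset.sum_subtype ({0}ᶜ : Finset F) (p := fun s => s ≠ 0) (by simp)]
  exact (Fintype.sum_equiv unitsEquivNeZero _ _ fun _ => rfl).symm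

theorem sum_units_addChar_mul {ψ : AddChar F ℂ} (hψ : ψ.IsPrimitive) (a : F) :
    ∑ u : Fˣ, ψ (a * u) = (if a = 0 then (Fintype.card F : ℂ) else 0) - 1 := by
  rw [← sum_ne_zero_addChar_mul hψ a,
    sum_eq_sum_units (fun y => if y = 0 then 0 else ψ (a * y)) (by simp)]
  simp

theorem sum_units_mulChar {χ : MulChar F ℂ} (hχ : χ ≠ 1) : ∑ u : Fˣ, χ u = 0 := by
  rw [← sum_eq_sum_units _ (MulChar.map_zero χ), MulChar.sum_eq_zero_of_ne_one hχ]

end SumUnits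

/-! ### Points on a nodal cubic -/

section NodalCubic

variable {F : Type*} [Field F]

theorem eq_one_of_sq_eq_zero_of_nodal {y z : F} (h : y ^ 2 * z + y * z ^ 2 - 3 * (y * z) + 1 = 0)
    (hp : y * z = 1) : y = 1 ∧ z = 1 := by
  have h1 : y + z = 2 := by linear_combination h - (y + z - 3) * hp
  have h2 : (y - 1) ^ 2 = 0 := by linear_combination y * h1 - hp
  have hy : y = 1 := by simpa [sub_eq_zero] using h2
  exact ⟨hy, by linear_combination h1 - hy⟩

/-- The node `(1, 1)` is the only point of the curve at which any of these expressions vanishes;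
they are the denominators and excluded values in the parametrization by lines through the node. -/
theorem nodal_nondegenerate {y z : F} (h : y ^ 2 * z + y * z ^ 2 - 3 * (y * z) + 1 = 0)
    (hne : ¬(y = 1 ∧ z = 1)) :
    y - 1 ≠ 0 ∧ z - 1 ≠ 0 ∧ y + z - 2 ≠ 0 ∧
      (y - 1) ^ 2 + (y - 1) * (z - 1) + (z - 1) ^ 2 ≠ 0 := by
  refine ⟨fun h1 => hne ?_, fun h1 => hne ?_, fun h1 => hne ?_, fun h1 => hne ?_⟩
  · have hy : y = 1 := sub_eq_zero.1 h1
    have : (z - 1) ^ 2 = 0 := by rw [hy] at h; linear_combination h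
    exact ⟨hy, by simpa [sub_eq_zero] using this⟩
  · have hz : z = 1 := sub_eq_zero.1 h1
    have : (y - 1) ^ 2 = 0 := by rw [hz] at h; linear_combination h
    exact ⟨by simpa [sub_eq_zero] using this, hz⟩
  · exact eq_one_of_sq_eq_zero_of_nodal h (by linear_combination -h + y * z * h1)
  · apply eq_one_of_sq_eq_zero_of_nodal h
    have : (y * z - 1) ^ 3 = 0 := by
      linear_combination -(y * z) * (y * z * h1 - (y + z) * h) - h
    simpa [sub_eq_zero] using this

variable [Fintype F] [DecidableEq F]

/-- Lines through the node `(1, 1)` parametrize the curve by the slope `t = (y - 1)/(z - 1)`. The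
values `0` and `-1` give no affine point with nonzero coordinates, and the two roots of `t² + t + 1`
are the tangent directions at the node. This leaves `q - 4` points, and the node itself makes `q -
3`. -/
theorem card_nodal (h3 : (3 : F) ≠ 0) {ω : F} (hω : ω ^ 2 + ω + 1 = 0) :
    (Finset.univ.filter fun u : F × F => u.1 ≠ 0 ∧ u.2 ≠ 0 ∧
      u.1 ^ 2 * u.2 + u.1 * u.2 ^ 2 - 3 * (u.1 * u.2) + 1 = 0).card + 3 = Fintype.card F := by
  set T : Finset F := Finset.univ.filter fun t => t ≠ 0 ∧ 1 + t ≠ 0 ∧ t ^ 2 + t + 1 ≠ 0 with hT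
  set Z : Finset (F × F) := Finset.univ.filter fun u : F × F => u.1 ≠ 0 ∧ u.2 ≠ 0 ∧
      u.1 ^ 2 * u.2 + u.1 * u.2 ^ 2 - 3 * (u.1 * u.2) + 1 = 0 with hZ
  have hTc : T.card + 4 = Fintype.card F := by
    have hc : Tᶜ = {0, -1, ω, -1 - ω} := by
      ext t
      simp only [hT, Finset.mem_compl, Finset.mem_filter, Finset.mem_univ, true_and,
        Finset.mem_insert, Finset.mem_singleton]
      have e : t ^ 2 + t + 1 = (t - ω) * (t - (-1 - ω)) := by linear_combination hω
      rw [e, mul_ne_zero_iff, sub_ne_zero, sub_ne_zero, ne_eq, ne_eq, ne_eq, ne_eq,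
        show (1 + t = 0 ↔ t = -1) from ⟨fun h => by linear_combination h,
          fun h => by linear_combination h⟩]
      tauto
    have hcard : ({0, -1, ω, -1 - ω} : Finset F).card = 4 := by
      have a1 : ω ≠ 0 := by rintro rfl; simp at hω
      have a2 : ω ≠ -1 := by rintro rfl; simp at hω
      have a3 : ω ≠ -1 - ω := by
        intro h
        exact h3 (by linear_combination 4 * hω - (2 * ω + 1) * h)
      have a4 : (0 : F) ≠ -1 - ω := fun h => a2 (by linear_combination h)
      have a5 : (-1 : F) ≠ -1 - ω := fun h => a1 (by linear_combination h)
      rw [Finset.card_insert_of_notMem, Finset.card_insert_of_notMem,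
        Finset.card_insert_of_notMem, Finset.card_singleton]
      · simpa using a3
      · simpa using ⟨a2.symm, a5⟩
      · simpa using ⟨a1.symm, a4⟩
    rw [← hcard, ← hc, Finset.card_add_card_compl]
  have h11 : (1, 1) ∈ Z := by
    simp only [hZ, Finset.mem_filter, Finset.mem_univ, true_and]
    exact ⟨one_ne_zero, one_ne_zero, by ring⟩
  have hbij : T.card = (Z.erase (1, 1)).card := by
    refine Finset.card_nbij' (fun t => (-t ^ 2 / (1 + t), -1 / (t * (1 + t))))
      (fun u => (u.1 - 1) / (u.2 - 1)) ?_ ?_ ?_ ?_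
    · intro t ht
      obtain ⟨t0, t1, t2⟩ := (Finset.mem_filter.1 ht).2
      simp only [hZ, Finset.coe_erase, Set.mem_sdiff, Finset.mem_coe, Finset.mem_filter,
        Finset.mem_univ, true_and, Set.mem_singleton_iff, Prod.mk.injEq]
      refine ⟨⟨by simp [t0, t1], by simp [t0, t1], by field_simp; ring⟩, fun h => t2 ?_⟩
      have := h.1
      field_simp at this
      linear_combination -this
    · intro u hu
      simp only [hZ, Finset.coe_erase, Set.mem_sdiff, Finset.mem_coe, Finset.mem_filter,
        Finset.mem_univ, true_and, Set.mem_singleton_iff, Prod.ext_iff] at hu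
      obtain ⟨n1, n2, n3, n4⟩ := nodal_nondegenerate hu.1.2.2 hu.2
      simp only [hT, Finset.coe_filter, Finset.mem_univ, true_and, Set.mem_ofPred_eq]
      refine ⟨div_ne_zero n1 n2, ?_, ?_⟩
      · rw [show 1 + (u.1 - 1) / (u.2 - 1) = (u.1 + u.2 - 2) / (u.2 - 1) by field_simp; ring]
        exact div_ne_zero n3 n2
      · rw [show ((u.1 - 1) / (u.2 - 1)) ^ 2 + (u.1 - 1) / (u.2 - 1) + 1 =
          ((u.1 - 1) ^ 2 + (u.1 - 1) * (u.2 - 1) + (u.2 - 1) ^ 2) / (u.2 - 1) ^ 2 by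
            field_simp]
        exact div_ne_zero n4 (pow_ne_zero 2 n2)
    · intro t ht
      obtain ⟨t0, t1, t2⟩ := (Finset.mem_filter.1 ht).2
      have e1 : -t ^ 2 / (1 + t) - 1 = -(t ^ 2 + t + 1) / (1 + t) := by field_simp; ring
      have e2 : -1 / (t * (1 + t)) - 1 = -(t ^ 2 + t + 1) / (t * (1 + t)) := by field_simp; ring
      simp only [e1, e2]
      generalize t ^ 2 + t + 1 = r at t2
      field_simp
    · intro u hu
      simp only [hZ, Finset.coe_erase, Set.mem_sdiff, Finset.mem_coe, Finset.mem_filter,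
        Finset.mem_univ, true_and, Set.mem_singleton_iff, Prod.ext_iff] at hu
      obtain ⟨n1, n2, n3, n4⟩ := nodal_nondegenerate hu.1.2.2 hu.2
      have e : 1 + (u.1 - 1) / (u.2 - 1) = (u.1 + u.2 - 2) / (u.2 - 1) := by field_simp; ring
      ext
      · simp only [e]
        field_simp
        linear_combination -hu.1.2.2
      · simp only [e]
        field_simp
        linear_combination -hu.1.2.2
  rw [Finset.card_erase_of_mem h11] at hbij
  have := Finset.card_pos.2 ⟨_, h11⟩
  omega

end NodalCubic

/-! ### Cube roots of unity and cubic characters -/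

section CubeRoots

variable {F : Type*} [Field F] {η : MulChar F ℂ}

theorem units_pow_three_eq_one_iff {ω : F} (hω : ω ^ 2 + ω + 1 = 0) (hω0 : ω ≠ 0) (t : Fˣ) :
    t ^ 3 = 1 ↔ t = 1 ∨ t = Units.mk0 ω hω0 ∨ t = Units.mk0 ω hω0 ^ 2 := by
  have e : (t : F) ^ 3 - 1 = (t - 1) * ((t - ω) * (t - ω ^ 2)) := by
    linear_combination ((t : F) - 1) * (t + 1 - ω) * hω
  have h1 : t ^ 3 = 1 ↔ (t : F) ^ 3 - 1 = 0 := by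
    rw [sub_eq_zero, Units.ext_iff]
    simp
  rw [h1, e, mul_eq_zero, mul_eq_zero, sub_eq_zero, sub_eq_zero, sub_eq_zero]
  simp only [Units.ext_iff, Units.val_one, Units.val_pow_eq_pow_val, Units.val_mk0]

theorem MulChar.apply_pow_three (hη3 : η ^ 3 = 1) {a : F} (ha : a ≠ 0) : η a ^ 3 = 1 := by
  rw [← MulChar.pow_apply' _ (by norm_num), hη3, MulChar.one_apply ha.isUnit]

/-- On the curve `y(z - 1)³ = z(y - 1)³`, so `y/z` is a cube away from the node. -/
theorem apply_mul_inv_apply_of_nodal (hη3 : η ^ 3 = 1) {y z : F} (hz : z ≠ 0)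
    (h : y ^ 2 * z + y * z ^ 2 - 3 * (y * z) + 1 = 0) : η y * η⁻¹ z = 1 := by
  by_cases hyz : y = 1 ∧ z = 1
  · rw [hyz.1, hyz.2]
    simp
  obtain ⟨n1, n2, -, -⟩ := nodal_nondegenerate h hyz
  have e : y * (z - 1) ^ 3 = z * (y - 1) ^ 3 := by linear_combination (z - y) * h
  have e' := congrArg η e
  rw [map_mul, map_mul, map_pow, map_pow, MulChar.apply_pow_three hη3 n1,
    MulChar.apply_pow_three hη3 n2, mul_one, mul_one] at e'
  rw [e', η.apply_mul_inv_apply hz]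

theorem sq_add_self_add_one_eq_zero {K : Type*} [Field K] {a : K} (h3 : a ^ 3 = 1) (h1 : a ≠ 1) :
    a ^ 2 + a + 1 = 0 := by
  have : (a - 1) * (a ^ 2 + a + 1) = 0 := by linear_combination h3
  exact (mul_eq_zero.1 this).resolve_left (sub_ne_zero.2 h1)

theorem MulChar.inv_apply_of_pow_three (hη3 : η ^ 3 = 1) {a : F} (ha : a ≠ 0) :
    η⁻¹ a = η a ^ 2 := by
  have h := η.inv_apply_mul_apply ha
  have h' := MulChar.apply_pow_three hη3 ha
  linear_combination η a ^ 2 * h - η⁻¹ a * h'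

end CubeRoots

/-! ### The twisted Kloosterman sum as a sum over cube roots -/

section CubicKloosterman

variable {F : Type*} [Field F] [Fintype F] [DecidableEq F]

theorem card_units_pow_three_eq_one {ω : F} (hω : ω ^ 2 + ω + 1 = 0) (h3 : (3 : F) ≠ 0) :
    (Finset.univ.filter fun t : Fˣ => t ^ 3 = 1).card = 3 := by
  have hω0 : ω ≠ 0 := by rintro rfl; simp at hω
  have hω1 : ω ≠ 1 := by rintro rfl; exact h3 (by linear_combination hω)
  have e : (Finset.univ.filter fun t : Fˣ => t ^ 3 = 1) =
      {1, Units.mk0 ω hω0, Units.mk0 ω hω0 ^ 2} := by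
    ext t
    simp [units_pow_three_eq_one_iff hω hω0]
  have n1 : Units.mk0 ω hω0 ≠ 1 := fun h => hω1 (by simpa [Units.ext_iff] using h)
  have n2 : Units.mk0 ω hω0 ≠ Units.mk0 ω hω0 ^ 2 := by
    intro h
    rw [sq, left_eq_mul] at h
    exact n1 h
  have n3 : 1 ≠ Units.mk0 ω hω0 ^ 2 := by
    intro h
    have h' : ω ^ 2 = 1 := by simpa [Units.ext_iff] using h.symm
    have h'' : ω = -2 := by linear_combination hω - h'
    rw [h''] at h'
    exact h3 (by linear_combination h')
  rw [e, Finset.card_insert_of_notMem, Finset.card_insert_of_notMem, Finset.card_singleton]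
  · simpa using n2
  · simp only [Finset.mem_insert, Finset.mem_singleton, not_or]
    exact ⟨n1.symm, n3⟩

/-- The Kloosterman sum in three variables with product `w`, twisted by `η` and `η⁻¹`. -/
noncomputable def cubicKloosterman (ψ : AddChar F ℂ) (η : MulChar F ℂ) (w : Fˣ) : ℂ :=
  ∑ y : Fˣ, ∑ z : Fˣ, η y * η⁻¹ z * ψ ((w * y⁻¹ * z⁻¹ : Fˣ) + y + z)

/-- The sum of `ψ` over the cube roots of `c ^ 3 * w`. -/
noncomputable def cubeRootSum (ψ : AddChar F ℂ) (c w : Fˣ) : ℂ :=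
  ∑ s : Fˣ, if s ^ 3 = c ^ 3 * w then ψ s else 0

variable {ψ : AddChar F ℂ} {η : MulChar F ℂ}

theorem sum_mul_ite_units (f : Fˣ → ℂ) (b : Fˣ) (q : ℂ) :
    ∑ c, f c * (if b * c = 1 then q else 0) = q * f b⁻¹ := by
  simp only [← inv_eq_iff_mul_eq_one, mul_ite, mul_zero, Finset.sum_ite_eq, Finset.mem_univ,
    if_true]
  ring

theorem sum_units_addChar_sub_one (hψ : ψ.IsPrimitive) (b : Fˣ) :
    ∑ u : Fˣ, ψ (((b : F) - 1) * u) = (if b = 1 then (Fintype.card F : ℂ) else 0) - 1 := by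
  rw [sum_units_addChar_mul hψ]
  simp only [sub_eq_zero, Units.val_eq_one]

/-- Let `x, y, z` be the variables of the conjugate sum and `b, c` the ratios of the others to `y,
z`. Summing over `x, y, z` gives a product of three factors `q·[condition] - 1`, with conditions `bc
= 1`, `b = 1`, `c = 1`. Any two conditions force `b = c = 1`, which yields `q³ - 3q²`; terms with at
most one condition vanish since `η`, `η̄`, `η²` are nontrivial. -/
theorem sum_cubicKloosterman_mul_star (hψ : ψ.IsPrimitive) (hη : η ≠ 1) (hη3 : η ^ 3 = 1) :
    ∑ w, cubicKloosterman ψ η w * star (cubicKloosterman ψ η w) =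
      (Fintype.card F : ℂ) ^ 2 * (Fintype.card F - 3) := by
  set q : ℂ := (Fintype.card F : ℂ) with hq
  have hstar (w : Fˣ) : star (cubicKloosterman ψ η w) =
      ∑ y : Fˣ, ∑ z : Fˣ, η⁻¹ y * η z * ψ (-((w * y⁻¹ * z⁻¹ : Fˣ) + y + z)) := by
    simp only [cubicKloosterman, star_sum, star_mul', MulChar.star_apply', inv_inv,
      AddChar.map_neg_eq_conj, starRingEnd_apply]
  have h1 : ∀ y z : Fˣ, ∑ w, cubicKloosterman ψ η w *
      (η⁻¹ y * η z * ψ (-((w * y⁻¹ * z⁻¹ : Fˣ) + y + z))) =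
      ∑ x : Fˣ, ∑ b : Fˣ, ∑ c : Fˣ, η b * η⁻¹ c * (ψ ((((b * c)⁻¹ : Fˣ) - 1) * x) *
        ψ (((b : F) - 1) * y) * ψ (((c : F) - 1) * z)) := by
    intro y z
    rw [← Equiv.sum_comp (Equiv.mulRight (y * z))]
    refine Finset.sum_congr rfl fun x _ => ?_
    rw [cubicKloosterman, ← Equiv.sum_comp (Equiv.mulRight y), Finset.sum_mul]
    refine Finset.sum_congr rfl fun b _ => ?_
    rw [← Equiv.sum_comp (Equiv.mulRight z), Finset.sum_mul]
    refine Finset.sum_congr rfl fun c _ => ?_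
    simp only [Equiv.coe_mulRight, ← AddChar.map_add_eq_mul]
    have e1 : x * (y * z) * (b * y)⁻¹ * (c * z)⁻¹ = (b * c)⁻¹ * x := by
      apply Units.ext
      push_cast
      field_simp
    have e2 : x * (y * z) * y⁻¹ * z⁻¹ = x := by
      apply Units.ext
      push_cast
      field_simp
    rw [e1, e2]
    have e3 : (((b * c)⁻¹ * x : Fˣ) : F) + (b * y : Fˣ) + (c * z : Fˣ) + -((x : F) + y + z) =
        (((b * c)⁻¹ : Fˣ) - 1) * (x : F) + ((b : F) - 1) * y + ((c : F) - 1) * z := by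
      push_cast
      ring
    rw [← e3, AddChar.map_add_eq_mul ψ _ (-((x : F) + y + z)), Units.val_mul b, Units.val_mul c,
      map_mul, map_mul]
    generalize ψ (((b * c)⁻¹ * x : Fˣ) + b * y + c * z) = p
    linear_combination (η b * η⁻¹ c * p * ψ (-(x + y + z))) *
      ((η⁻¹ z * η z) * η.inv_apply_mul_apply y.ne_zero +
        η.inv_apply_mul_apply z.ne_zero)
  have h2 : ∑ w, cubicKloosterman ψ η w * star (cubicKloosterman ψ η w) =
      ∑ b : Fˣ, ∑ c : Fˣ, η b * η⁻¹ c * (((if b * c = 1 then q else 0) - 1) *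
        ((if b = 1 then q else 0) - 1) * ((if c = 1 then q else 0) - 1)) := by
    have hbc (b c : Fˣ) : (if b * c = 1 then q else 0) - 1 =
        ∑ x : Fˣ, ψ ((((b * c)⁻¹ : Fˣ) - 1) * x) := by
      rw [sum_units_addChar_sub_one hψ]
      simp only [inv_eq_one, hq]
    simp only [hbc]
    simp only [hq, ← sum_units_addChar_sub_one hψ, hstar, Finset.mul_sum (s := Finset.univ)]
    rw [Finset.sum_comm]
    have : ∀ y : Fˣ, ∑ w, ∑ z : Fˣ, cubicKloosterman ψ η w *
        (η⁻¹ y * η z * ψ (-((w * y⁻¹ * z⁻¹ : Fˣ) + y + z))) =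
        ∑ z : Fˣ, ∑ x : Fˣ, ∑ b : Fˣ, ∑ c : Fˣ, η b * η⁻¹ c *
          (ψ ((((b * c)⁻¹ : Fˣ) - 1) * x) *
            ψ (((b : F) - 1) * y) * ψ (((c : F) - 1) * z)) := by
      intro y
      rw [Finset.sum_comm]
      exact Finset.sum_congr rfl fun z _ => h1 y z
    rw [Finset.sum_congr rfl fun y _ => this y]
    simp only [Finset.sum_mul, Finset.mul_sum, ← Fintype.sum_prod_type']
    let f : Fˣ × Fˣ × Fˣ × Fˣ × Fˣ → Fˣ × Fˣ × Fˣ × Fˣ × Fˣ :=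
      fun t => (t.2.2.2.1, t.2.2.2.2, t.2.1, t.1, t.2.2.1)
    let g : Fˣ × Fˣ × Fˣ × Fˣ × Fˣ → Fˣ × Fˣ × Fˣ × Fˣ × Fˣ :=
      fun t => (t.2.2.2.1, t.2.2.1, t.2.2.2.2, t.1, t.2.1)
    exact Fintype.sum_equiv ⟨f, g, fun _ => rfl, fun _ => rfl⟩ _ _ fun _ => rfl
  have s1 : ∑ u : Fˣ, η u = 0 := sum_units_mulChar hη
  have s2 : ∑ u : Fˣ, η⁻¹ u = 0 := sum_units_mulChar (inv_ne_one.2 hη)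
  have s3 : ∑ u : Fˣ, η u * η u = 0 := by
    have : η * η = η⁻¹ := by rw [eq_inv_iff_mul_eq_one, ← hη3, pow_three, mul_assoc]
    simp only [← MulChar.mul_apply, this, s2]
  have row : ∀ b : Fˣ, ∑ c : Fˣ, η b * η⁻¹ c * (((if b * c = 1 then q else 0) - 1) *
        ((if b = 1 then q else 0) - 1) * ((if c = 1 then q else 0) - 1)) =
      η b * (q * (if b = 1 then q else 0) - 2 * q - q * η b) * (if 1 * b = 1 then q else 0) +
        q * η b + q * (η b * η b) := by
    intro b
    have r1 := sum_mul_ite_units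
      (fun c => η⁻¹ c * ((if b * c = 1 then q else 0) - 1)) 1 q
    have r2 := sum_mul_ite_units (fun c : Fˣ => η⁻¹ c) b q
    simp only [one_mul, inv_one, mul_one, Units.val_one, map_one] at r1
    have r3 : η⁻¹ (b⁻¹ : Fˣ) = η b := by
      rw [MulChar.inv_apply']
      simp
    rw [r3] at r2
    have r : ∑ c : Fˣ, (η⁻¹ c * ((if b * c = 1 then q else 0) - 1) * (if c = 1 then q else 0) -
        η⁻¹ c * (if b * c = 1 then q else 0) + η⁻¹ c) =
        q * ((if b = 1 then q else 0) - 1) - q * η b := by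
      rw [Finset.sum_add_distrib, Finset.sum_sub_distrib, r1, r2, s2, add_zero]
    rw [one_mul]
    trans η b * ((if b = 1 then q else 0) - 1) * (q * ((if b = 1 then q else 0) - 1) - q * η b)
    · rw [← r, Finset.mul_sum]
      exact Finset.sum_congr rfl fun c _ => by ring
    · ring
  have r1 := sum_mul_ite_units
    (fun b : Fˣ => η b * (q * (if b = 1 then q else 0) - 2 * q - q * η b)) 1 q
  rw [h2, Finset.sum_congr rfl fun b _ => row b, Finset.sum_add_distrib, Finset.sum_add_distrib,
    r1, ← Finset.mul_sum, ← Finset.mul_sum, s1, s3]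
  simp only [inv_one, if_true, Units.val_one, map_one]
  ring

theorem star_cubeRootSum (c w : Fˣ) :
    star (cubeRootSum ψ c w) = ∑ s : Fˣ, if s ^ 3 = c ^ 3 * w then ψ (-s) else 0 := by
  rw [cubeRootSum, star_sum]
  refine Finset.sum_congr rfl fun s _ => ?_
  rw [AddChar.map_neg_eq_conj, starRingEnd_apply]
  split_ifs <;> simp

theorem sum_mul_star_cubeRootSum (f : Fˣ → ℂ) (c : Fˣ) :
    ∑ w, f w * star (cubeRootSum ψ c w) = ∑ s : Fˣ, f ((c⁻¹ * s) ^ 3) * ψ (-s) := by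
  simp only [star_cubeRootSum, Finset.mul_sum]
  rw [Finset.sum_comm]
  refine Finset.sum_congr rfl fun s _ => ?_
  rw [Finset.sum_eq_single ((c⁻¹ * s) ^ 3)]
  · rw [if_pos (by rw [mul_pow, inv_pow, mul_inv_cancel_left])]
  · intro w _ hw
    rw [if_neg, mul_zero]
    intro h
    exact hw (by rw [mul_pow, inv_pow, h, inv_mul_cancel_left])
  · simp

/-- Two elements with the same cube differ by a cube root of unity `t`. The sum over `s` is `q - 1`
for `t = 1` and `-1` for the two others. -/
theorem sum_cubeRootSum_mul_star (hψ : ψ.IsPrimitive) (h3 : (3 : F) ≠ 0) {ω : F}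
    (hω : ω ^ 2 + ω + 1 = 0) (c : Fˣ) :
    ∑ w, cubeRootSum ψ c w * star (cubeRootSum ψ c w) = (Fintype.card F : ℂ) - 3 := by
  rw [sum_mul_star_cubeRootSum]
  have h1 : ∀ s : Fˣ, cubeRootSum ψ c ((c⁻¹ * s) ^ 3) * ψ (-s) =
      ∑ t : Fˣ, if t ^ 3 = 1 then ψ (((t : F) - 1) * s) else 0 := by
    intro s
    rw [cubeRootSum, ← Equiv.sum_comp (Equiv.mulRight s), Finset.sum_mul]
    refine Finset.sum_congr rfl fun t _ => ?_
    simp only [Equiv.coe_mulRight, mul_pow, inv_pow, mul_inv_cancel_left, mul_eq_right]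
    split_ifs
    · rw [← AddChar.map_add_eq_mul]
      congr 1
      push_cast
      ring
    · simp
  rw [Finset.sum_congr rfl fun s _ => h1 s, Finset.sum_comm]
  have h2 : ∀ t : Fˣ, (∑ s : Fˣ, if t ^ 3 = 1 then ψ (((t : F) - 1) * s) else 0) =
      (if t = 1 then (Fintype.card F : ℂ) else 0) - if t ^ 3 = 1 then 1 else 0 := by
    intro t
    by_cases h : t ^ 3 = 1
    · simp only [if_pos h]
      exact sum_units_addChar_sub_one hψ t
    · have : t ≠ 1 := by rintro rfl; simp at h
      simp [h, this]
  rw [Finset.sum_congr rfl fun t _ => h2 t, Finset.sum_sub_distrib, Finset.sum_ite_eq',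
    if_pos (Finset.mem_univ _), Finset.sum_boole, card_units_pow_three_eq_one hω h3]
  norm_num

/-- Scaling `y` and `z` by `s/3` makes the exponent linear in `s`. Its coefficient vanishes exactly
on the nodal cubic, where the twist `η(y)η̄(z)` is `1`, so each of the `q - 3` points contributes
`q`; the remaining `-1` terms cancel by orthogonality. -/
theorem sum_cubicKloosterman_mul_star_cubeRootSum (hψ : ψ.IsPrimitive) (hη : η ≠ 1)
    (hη3 : η ^ 3 = 1) {ω : F} (hω : ω ^ 2 + ω + 1 = 0) {c : Fˣ} (hc : (c : F) = 3) :
    ∑ w, cubicKloosterman ψ η w * star (cubeRootSum ψ c w) =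
      (Fintype.card F : ℂ) * (Fintype.card F - 3) := by
  have h3 : (3 : F) ≠ 0 := hc ▸ c.ne_zero
  rw [sum_mul_star_cubeRootSum]
  have h1 : ∀ s : Fˣ, cubicKloosterman ψ η ((c⁻¹ * s) ^ 3) * ψ (-s) =
      ∑ y : Fˣ, ∑ z : Fˣ, η y * η⁻¹ z *
        ψ ((((c⁻¹ : Fˣ) : F) * (((y * z)⁻¹ : Fˣ) + y + z) - 1) * s) := by
    intro s
    rw [cubicKloosterman, ← Equiv.sum_comp (Equiv.mulRight (c⁻¹ * s)), Finset.sum_mul]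
    refine Finset.sum_congr rfl fun y _ => ?_
    rw [← Equiv.sum_comp (Equiv.mulRight (c⁻¹ * s)), Finset.sum_mul]
    refine Finset.sum_congr rfl fun z _ => ?_
    simp only [Equiv.coe_mulRight]
    have e1 : (c⁻¹ * s) ^ 3 * (y * (c⁻¹ * s))⁻¹ * (z * (c⁻¹ * s))⁻¹ =
        c⁻¹ * (y * z)⁻¹ * s := by
      apply Units.ext
      push_cast
      field_simp
    have e2 : η (y * (c⁻¹ * s) : Fˣ) * η⁻¹ (z * (c⁻¹ * s) : Fˣ) = η y * η⁻¹ z := by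
      rw [Units.val_mul y, Units.val_mul z, map_mul, map_mul]
      linear_combination (η y * η⁻¹ z) * η.apply_mul_inv_apply (c⁻¹ * s).ne_zero
    rw [e1, e2, mul_assoc, ← AddChar.map_add_eq_mul]
    congr 2
    push_cast
    ring
  have h2 : ∀ y z : Fˣ, (∑ s : Fˣ, η y * η⁻¹ z *
        ψ ((((c⁻¹ : Fˣ) : F) * (((y * z)⁻¹ : Fˣ) + y + z) - 1) * s)) =
      (if (y : F) ≠ 0 ∧ (z : F) ≠ 0 ∧ (y : F) ^ 2 * z + y * z ^ 2 - 3 * (y * z) + 1 = 0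
        then (Fintype.card F : ℂ) else 0) - η y * η⁻¹ z := by
    intro y z
    rw [← Finset.mul_sum, sum_units_addChar_mul hψ]
    have hiff : ((c⁻¹ : Fˣ) : F) * (((y * z)⁻¹ : Fˣ) + y + z) - 1 = 0 ↔
        ((y : F) ≠ 0 ∧ (z : F) ≠ 0 ∧ (y : F) ^ 2 * z + y * z ^ 2 - 3 * (y * z) + 1 = 0) := by
      have hy := y.ne_zero
      have hz := z.ne_zero
      simp only [ne_eq, hy, hz, not_false_eq_true, true_and]
      push_cast
      rw [hc]
      constructor
      · intro h
        field_simp at h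
        linear_combination h
      · intro h
        field_simp
        linear_combination h
    simp only [hiff]
    split_ifs with h
    · rw [apply_mul_inv_apply_of_nodal hη3 h.2.1 h.2.2]
      ring
    · ring
  have h4 : ∑ y : Fˣ, ∑ z : Fˣ,
      (if (y : F) ≠ 0 ∧ (z : F) ≠ 0 ∧ (y : F) ^ 2 * z + y * z ^ 2 - 3 * (y * z) + 1 = 0
        then (Fintype.card F : ℂ) else 0) = (Fintype.card F : ℂ) * (Fintype.card F - 3) := by
    have a1 : ∀ y : Fˣ, ∑ z : Fˣ,
        (if (y : F) ≠ 0 ∧ (z : F) ≠ 0 ∧ (y : F) ^ 2 * z + y * z ^ 2 - 3 * (y * z) + 1 = 0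
          then (Fintype.card F : ℂ) else 0) = ∑ z : F,
        (if (y : F) ≠ 0 ∧ z ≠ 0 ∧ (y : F) ^ 2 * z + y * z ^ 2 - 3 * (y * z) + 1 = 0
          then (Fintype.card F : ℂ) else 0) := fun y =>
      (sum_eq_sum_units (fun z : F =>
        if (y : F) ≠ 0 ∧ z ≠ 0 ∧ (y : F) ^ 2 * z + y * z ^ 2 - 3 * (y * z) + 1 = 0
          then (Fintype.card F : ℂ) else 0) (by simp)).symm
    rw [Finset.sum_congr rfl fun y _ => a1 y, ← sum_eq_sum_units (fun y : F => ∑ z : F,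
        if y ≠ 0 ∧ z ≠ 0 ∧ y ^ 2 * z + y * z ^ 2 - 3 * (y * z) + 1 = 0
          then (Fintype.card F : ℂ) else 0) (by simp), ← Fintype.sum_prod_type', ← Finset.sum_filter,
      Finset.sum_const, nsmul_eq_mul, mul_comm]
    have := card_nodal h3 hω
    rw [← this]
    push_cast
    ring
  have h5 : ∑ y : Fˣ, ∑ z : Fˣ, η y * η⁻¹ z = 0 := by
    simp only [← Finset.mul_sum, sum_units_mulChar (inv_ne_one.2 hη), mul_zero,
      Finset.sum_const_zero]
  calc _ = ∑ s : Fˣ, ∑ y : Fˣ, ∑ z : Fˣ, η y * η⁻¹ z *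
        ψ ((((c⁻¹ : Fˣ) : F) * (((y * z)⁻¹ : Fˣ) + y + z) - 1) * s) :=
        Finset.sum_congr rfl fun s _ => h1 s
    _ = ∑ y : Fˣ, ∑ z : Fˣ, ∑ s : Fˣ, η y * η⁻¹ z *
        ψ ((((c⁻¹ : Fˣ) : F) * (((y * z)⁻¹ : Fˣ) + y + z) - 1) * s) := by
        rw [Finset.sum_comm]
        exact Finset.sum_congr rfl fun y _ => Finset.sum_comm
    _ = _ := by
        simp only [h2, Finset.sum_sub_distrib, h5, sub_zero]
        exact h4

/-- The twisted cubic Kloosterman sum is an exponential sum over cube roots; this is the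
Hasse–Davenport product formula for cubic characters in its additive form. -/
theorem cubicKloosterman_eq (hψ : ψ.IsPrimitive) (hη : η ≠ 1)
    (hη3 : η ^ 3 = 1) {ω : F} (hω : ω ^ 2 + ω + 1 = 0) {c : Fˣ} (hc : (c : F) = 3) (w : Fˣ) :
    cubicKloosterman ψ η w = Fintype.card F * cubeRootSum ψ c w := by
  have h3 : (3 : F) ≠ 0 := hc ▸ c.ne_zero
  set q : ℂ := (Fintype.card F : ℂ) with hq
  have h1 := sum_cubicKloosterman_mul_star hψ hη hη3
  have h2 := sum_cubicKloosterman_mul_star_cubeRootSum hψ hη hη3 hω hc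
  have h4 := sum_cubeRootSum_mul_star hψ h3 hω c
  have hqs : star q = q := by simp [hq]
  have h5 : ∑ w, cubeRootSum ψ c w * star (cubicKloosterman ψ η w) = q * (q - 3) := by
    have := congrArg star h2
    simp only [star_sum, star_mul', star_star, star_sub, ← hq, hqs] at this
    rw [← Finset.sum_congr rfl fun w _ => mul_comm _ _, this]
    simp
  -- Expanding the squared distance gives `q²(q - 3) - 2q·q(q - 3) + q²(q - 3) = 0`.
  have key : ∑ w, (cubicKloosterman ψ η w - q * cubeRootSum ψ c w) *
      star (cubicKloosterman ψ η w - q * cubeRootSum ψ c w) = 0 := by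
    have e : ∀ w, (cubicKloosterman ψ η w - q * cubeRootSum ψ c w) *
        star (cubicKloosterman ψ η w - q * cubeRootSum ψ c w) =
        cubicKloosterman ψ η w * star (cubicKloosterman ψ η w) -
        q * (cubicKloosterman ψ η w * star (cubeRootSum ψ c w)) -
        q * (cubeRootSum ψ c w * star (cubicKloosterman ψ η w)) +
        q ^ 2 * (cubeRootSum ψ c w * star (cubeRootSum ψ c w)) := by
      intro w
      rw [star_sub, star_mul', hqs]
      ring
    rw [Finset.sum_congr rfl fun w _ => e w, Finset.sum_add_distrib, Finset.sum_sub_distrib,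
      Finset.sum_sub_distrib, ← Finset.mul_sum, ← Finset.mul_sum, ← Finset.mul_sum, h1, h2, h4, h5]
    ring
  have key' : ∑ w, Complex.normSq (cubicKloosterman ψ η w - q * cubeRootSum ψ c w) = 0 := by
    have : ((∑ w, Complex.normSq (cubicKloosterman ψ η w - q * cubeRootSum ψ c w) : ℝ) : ℂ) = 0 := by
      rw [← key]
      push_cast
      exact Finset.sum_congr rfl fun w _ => (Complex.mul_conj _).symm
    exact_mod_cast this
  rw [Finset.sum_eq_zero_iff_of_nonneg fun w _ => Complex.normSq_nonneg _] at key'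
  exact sub_eq_zero.1 (Complex.normSq_eq_zero.1 (key' w (Finset.mem_univ w)))

end CubicKloosterman

/-! ### Additive expansion of the cubic period -/

section PeriodExpansion

variable {F : Type*} [Field F] [Fintype F] {ψ : AddChar F ℂ} {η : MulChar F ℂ}

theorem gaussSum_mul_hypP_cubic_aux {A V W : MulChar F ℂ} (hA : A ≠ 1) (hV : V⁻¹ * (A * η) ≠ 1)
    (hW : W⁻¹ * (A * η⁻¹) ≠ 1) (t : F) :
    gaussSum A ψ * gaussSum (V⁻¹ * (A * η)) ψ * gaussSum (W⁻¹ * (A * η⁻¹)) ψ *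
        hypP 2 ![A, A * η, A * η⁻¹] ![V, W] t =
      ∑ v, ∑ w, V⁻¹ v * W⁻¹ w * ψ (v + w) * ∑ s, ∑ y, ∑ z,
        A s * (A * η) y * (A * η⁻¹) z * ψ (s + y + z) * ψ (-(t * (s * y * z) / (v * w))) := by
  have hinv {X Y : MulChar F ℂ} (hX : X⁻¹ * Y ≠ 1) (u : F) :
      gaussSum (X⁻¹ * Y) ψ * (Y⁻¹ * X) u = ∑ a, (X⁻¹ * Y) a * ψ (a * u) := by
    rw [sum_mulChar_mul_addChar hX, mul_inv, inv_inv, mul_comm, mul_comm X]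
  have hP : hypP 2 ![A, A * η, A * η⁻¹] ![V, W] t =
      ∑ z, ∑ y, (A * η⁻¹) z * ((A * η⁻¹)⁻¹ * W) (1 - z) *
        ((A * η) y * ((A * η)⁻¹ * V) (1 - y)) * A⁻¹ (1 - t * z * y) := by
    have l2 : Fin.last 2 = 2 := rfl
    have l1 : Fin.last 1 = 1 := rfl
    simp only [hypP, Finset.mul_sum]
    refine Finset.sum_congr rfl fun z _ => Finset.sum_congr rfl fun y _ => ?_
    simp [l1, l2]
    ring
  have key : ∀ z y, gaussSum A ψ * gaussSum (V⁻¹ * (A * η)) ψ * gaussSum (W⁻¹ * (A * η⁻¹)) ψ *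
      ((A * η⁻¹) z * ((A * η⁻¹)⁻¹ * W) (1 - z) *
        ((A * η) y * ((A * η)⁻¹ * V) (1 - y)) * A⁻¹ (1 - t * z * y)) =
      ∑ s, ∑ v, ∑ w, A s * (A * η) y * (A * η⁻¹) z * ((V⁻¹ * (A * η)) v * (W⁻¹ * (A * η⁻¹)) w) *
        ψ (s * (1 - t * z * y) + v * (1 - y) + w * (1 - z)) := by
    intro z y
    trans (A⁻¹ (1 - t * z * y) * gaussSum A ψ) *
      ((gaussSum (V⁻¹ * (A * η)) ψ * ((A * η)⁻¹ * V) (1 - y)) *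
        (gaussSum (W⁻¹ * (A * η⁻¹)) ψ * ((A * η⁻¹)⁻¹ * W) (1 - z))) *
      ((A * η) y * (A * η⁻¹) z)
    · ring
    rw [← sum_mulChar_mul_addChar hA, hinv hV, hinv hW, Finset.sum_mul_sum]
    rw [mul_assoc, Finset.sum_mul]
    refine Finset.sum_congr rfl fun s _ => ?_
    rw [Finset.sum_mul, Finset.mul_sum]
    refine Finset.sum_congr rfl fun v _ => ?_
    rw [Finset.sum_mul, Finset.mul_sum]
    refine Finset.sum_congr rfl fun w _ => ?_
    rw [AddChar.map_add_eq_mul, AddChar.map_add_eq_mul]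
    ring
  have hsub {X Y : MulChar F ℂ} {v : F} (hv : v ≠ 0) (y : F) :
      Y (-v⁻¹ * y) * (X⁻¹ * Y) v = Y (-1) * X⁻¹ v * Y y := by
    rw [MulChar.mul_apply, show -v⁻¹ * y = (-1) * v⁻¹ * y by ring, map_mul, map_mul,
      ← MulChar.inv_apply']
    linear_combination (Y (-1) * X⁻¹ v * Y y) * Y.inv_apply_mul_apply hv
  have inner : ∀ v w : F, (∑ s, ∑ y, ∑ z,
      A s * (A * η) y * (A * η⁻¹) z * ((V⁻¹ * (A * η)) v * (W⁻¹ * (A * η⁻¹)) w) *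
        ψ (s * (1 - t * z * y) + v * (1 - y) + w * (1 - z))) =
      V⁻¹ v * W⁻¹ w * ψ (v + w) * ∑ s, ∑ y, ∑ z,
        A s * (A * η) y * (A * η⁻¹) z * ψ (s + y + z) * ψ (-(t * (s * y * z) / (v * w))) := by
    intro v w
    rcases eq_or_ne v 0 with rfl | hv
    · simp [MulChar.map_zero]
    rcases eq_or_ne w 0 with rfl | hw
    · simp [MulChar.map_zero]
    rw [Finset.mul_sum]
    refine Finset.sum_congr rfl fun s _ => ?_
    -- Replacing `y` by `-y/v` and `z` by `-z/w` separates the exponent into `v + w`, `s + y + z`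
    -- and a term in the product `syz`; the signs cancel because `(Aη)(-1)(Aη̄)(-1) = 1`.
    rw [← sum_mul_left_comp (neg_ne_zero.2 (inv_ne_zero hv)), Finset.mul_sum]
    refine Finset.sum_congr rfl fun y _ => ?_
    rw [← sum_mul_left_comp (neg_ne_zero.2 (inv_ne_zero hw)), Finset.mul_sum]
    refine Finset.sum_congr rfl fun z _ => ?_
    have e1 : s * (1 - t * (-w⁻¹ * z) * (-v⁻¹ * y)) + v * (1 - -v⁻¹ * y) + w * (1 - -w⁻¹ * z) =
        v + w + (s + y + z + -(t * (s * y * z) / (v * w))) := by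
      field_simp
      ring
    have e2 : (A * η) (-1) * (A * η⁻¹) (-1) = 1 := by
      simp only [MulChar.mul_apply, MulChar.inv_neg_one]
      linear_combination (A (-1) * A (-1)) * η.neg_one_mul_self + A.neg_one_mul_self
    have e3 := hsub (X := V) (Y := A * η) hv y
    have e4 := hsub (X := W) (Y := A * η⁻¹) hw z
    rw [e1, AddChar.map_add_eq_mul ψ (v + w), AddChar.map_add_eq_mul ψ (s + y + z)]
    generalize ψ (v + w) = p
    generalize ψ (s + y + z) = p'
    generalize ψ (-(t * (s * y * z) / (v * w))) = p''
    linear_combination (A s * p * p' * p'') *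
      ((A * η⁻¹) (-w⁻¹ * z) * (W⁻¹ * (A * η⁻¹)) w * e3 +
        ((A * η) (-1) * V⁻¹ v * (A * η) y) * e4 +
        (V⁻¹ v * (A * η) y * W⁻¹ w * (A * η⁻¹) z) * e2)
  rw [hP, Finset.mul_sum]
  simp only [← inner]
  simp only [Finset.mul_sum, key]
  simp only [← Fintype.sum_prod_type']
  let f : F × F × F × F × F → F × F × F × F × F :=
    fun t => (t.2.2.2.1, t.2.2.2.2, t.2.2.1, t.2.1, t.1)
  let g : F × F × F × F × F → F × F × F × F × F :=
    fun t => (t.2.2.2.2, t.2.2.2.1, t.2.2.1, t.1, t.2.1)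
  exact Fintype.sum_equiv ⟨f, g, fun _ => rfl, fun _ => rfl⟩ _ _ fun _ => rfl

end PeriodExpansion

/-! ### Evaluation of the left-hand side -/

section LeftSide

variable {F : Type*} [Field F] [Fintype F] [DecidableEq F] {ψ : AddChar F ℂ} {η : MulChar F ℂ}

theorem sum_mul_cubicKloosterman (A : MulChar F ℂ) (f : F → ℂ) :
    ∑ s, ∑ y, ∑ z, A s * (A * η) y * (A * η⁻¹) z * ψ (s + y + z) * f (s * y * z) =
      ∑ w : Fˣ, A w * f w * cubicKloosterman ψ η w := by
  have h1 : ∑ s, ∑ y, ∑ z, A s * (A * η) y * (A * η⁻¹) z * ψ (s + y + z) * f (s * y * z) =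
      ∑ s : Fˣ, ∑ y : Fˣ, ∑ z : Fˣ,
        A s * (A * η) y * (A * η⁻¹) z * ψ (s + y + z) * f (s * y * z) := by
    rw [sum_eq_sum_units _ (by simp [MulChar.map_zero])]
    refine Finset.sum_congr rfl fun s _ => ?_
    rw [sum_eq_sum_units _ (by simp [MulChar.map_zero])]
    refine Finset.sum_congr rfl fun y _ => ?_
    rw [sum_eq_sum_units _ (by simp [MulChar.map_zero])]
  have h2 : ∀ y z : Fˣ, ∑ s : Fˣ,
      A s * (A * η) y * (A * η⁻¹) z * ψ (s + y + z) * f (s * y * z) =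
      ∑ w : Fˣ, A w * f w * (η y * η⁻¹ z * ψ ((w * y⁻¹ * z⁻¹ : Fˣ) + y + z)) := by
    intro y z
    rw [← Equiv.sum_comp (Equiv.mulRight (y⁻¹ * z⁻¹))]
    refine Finset.sum_congr rfl fun w _ => ?_
    have e1 : ((w * (y⁻¹ * z⁻¹) : Fˣ) : F) * y * z = w := by
      push_cast
      field_simp
    have e2 : A ((w * (y⁻¹ * z⁻¹) : Fˣ) : F) * A y * A z = A w := by
      rw [← map_mul, ← map_mul, e1]
    simp only [Equiv.coe_mulRight, e1, MulChar.mul_apply, mul_assoc w]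
    linear_combination (η y * η⁻¹ z * ψ ((w * (y⁻¹ * z⁻¹) : Fˣ) + y + z) * f w) * e2
  rw [h1, Finset.sum_comm]
  simp only [cubicKloosterman, Finset.mul_sum]
  rw [Finset.sum_comm (s := Finset.univ (α := Fˣ)) (t := Finset.univ (α := Fˣ))
    (f := fun w y => ∑ z : Fˣ, A w * f w * (η y * η⁻¹ z * ψ ((w * y⁻¹ * z⁻¹ : Fˣ) + y + z)))]
  refine Finset.sum_congr rfl fun y _ => ?_
  rw [Finset.sum_comm]
  conv_rhs => rw [Finset.sum_comm]
  exact Finset.sum_congr rfl fun z _ => h2 y z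

theorem sum_mul_cubeRootSum (c : Fˣ) (f : Fˣ → ℂ) :
    ∑ w, f w * cubeRootSum ψ c w = ∑ s : Fˣ, f ((c⁻¹ * s) ^ 3) * ψ s := by
  simp only [cubeRootSum, Finset.mul_sum]
  rw [Finset.sum_comm]
  refine Finset.sum_congr rfl fun s _ => ?_
  rw [Finset.sum_eq_single ((c⁻¹ * s) ^ 3)]
  · rw [if_pos (by rw [mul_pow, inv_pow, mul_inv_cancel_left])]
  · intro w _ hw
    rw [if_neg, mul_zero]
    intro h
    exact hw (by rw [mul_pow, inv_pow, h, inv_mul_cancel_left])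
  · simp

/-- Grouping by the product `w = syz` leaves a twisted Kloosterman sum; expressing it through cube
roots of `27w` replaces `w` by `s³/27`. -/
theorem sum_cubic_product (hψ : ψ.IsPrimitive) (hη : η ≠ 1) (hη3 : η ^ 3 = 1)
    (h3 : (3 : F) ≠ 0) {ω : F} (hω : ω ^ 2 + ω + 1 = 0) (A : MulChar F ℂ) (f : F → ℂ) :
    ∑ s, ∑ y, ∑ z, A s * (A * η) y * (A * η⁻¹) z * ψ (s + y + z) * f (s * y * z) =
      Fintype.card F * ∑ s, A (s ^ 3 / 27) * ψ s * f (s ^ 3 / 27) := by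
  rw [sum_mul_cubicKloosterman]
  have hc : ((Units.mk0 3 h3 : Fˣ) : F) = 3 := rfl
  have h1 : ∀ w : Fˣ, A w * f w * cubicKloosterman ψ η w =
      Fintype.card F * (A w * f w * cubeRootSum ψ (Units.mk0 3 h3) w) := by
    intro w
    rw [cubicKloosterman_eq hψ hη hη3 hω hc]
    ring
  rw [Finset.sum_congr rfl fun w _ => h1 w, ← Finset.mul_sum,
    sum_mul_cubeRootSum (Units.mk0 3 h3) (fun w : Fˣ => A w * f w),
    sum_eq_sum_units (fun s => A (s ^ 3 / 27) * ψ s * f (s ^ 3 / 27)) (by simp [MulChar.map_zero])]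
  congr 1
  refine Finset.sum_congr rfl fun s _ => ?_
  have e : (((Units.mk0 3 h3)⁻¹ * s) ^ 3 : Fˣ) = (s : F) ^ 3 / 27 := by
    push_cast
    rw [hc, mul_pow, inv_pow, div_eq_inv_mul]
    norm_num
  simp only [e]
  ring

/-- The Hasse–Davenport product formula for cubic characters. -/
theorem gaussSum_mul_gaussSum_cubic (hψ : ψ.IsPrimitive) (hη : η ≠ 1) (hη3 : η ^ 3 = 1)
    (h3 : (3 : F) ≠ 0) {ω : F} (hω : ω ^ 2 + ω + 1 = 0) (A : MulChar F ℂ) :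
    gaussSum A ψ * gaussSum (A * η) ψ * gaussSum (A * η⁻¹) ψ =
      Fintype.card F * (A⁻¹ 27 * gaussSum (A ^ 3) ψ) := by
  have h := sum_cubic_product hψ hη hη3 h3 hω A (fun _ => 1)
  simp only [mul_one] at h
  have e : ∑ s, A (s ^ 3 / 27) * ψ s = A⁻¹ 27 * gaussSum (A ^ 3) ψ := by
    rw [gaussSum, Finset.mul_sum]
    refine Finset.sum_congr rfl fun s _ => ?_
    rw [MulChar.apply_div, map_pow, MulChar.pow_apply' _ (by norm_num)]
    ring
  rw [← e, ← h]
  simp only [gaussSum]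
  rw [mul_assoc, Finset.sum_mul]
  refine Finset.sum_congr rfl fun s _ => ?_
  rw [Finset.sum_mul_sum, Finset.mul_sum]
  refine Finset.sum_congr rfl fun y _ => ?_
  rw [Finset.mul_sum]
  refine Finset.sum_congr rfl fun z _ => ?_
  rw [AddChar.map_add_eq_mul, AddChar.map_add_eq_mul]
  ring

theorem gaussSum_mul_hypP_cubic (hψ : ψ.IsPrimitive) (hη : η ≠ 1) (hη3 : η ^ 3 = 1)
    (h2 : (2 : F) ≠ 0) (h3 : (3 : F) ≠ 0) {ω : F} (hω : ω ^ 2 + ω + 1 = 0)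
    {A V W : MulChar F ℂ} (hA : A ≠ 1) (hV : V⁻¹ * (A * η) ≠ 1)
    (hW : W⁻¹ * (A * η⁻¹) ≠ 1) {x : F} (hx : 1 - x ≠ 0) :
    gaussSum A ψ * gaussSum (V⁻¹ * (A * η)) ψ * gaussSum (W⁻¹ * (A * η⁻¹)) ψ *
        hypP 2 ![A, A * η, A * η⁻¹] ![V, W] (27 * x ^ 2 / (4 * (1 - x) ^ 3)) =
      Fintype.card F * (A⁻¹ 27 * (A ^ 3) (1 - x) * cubicExpSum ψ (A ^ 3) V⁻¹ W⁻¹ x) := by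
  have h4 := four_ne_zero_of_two h2
  have h27 : (27 : F) ≠ 0 := by
    rw [show (27 : F) = 3 ^ 3 by norm_num]
    exact pow_ne_zero 3 h3
  rw [gaussSum_mul_hypP_cubic_aux hA hV hW]
  have h1 : ∀ v w, V⁻¹ v * W⁻¹ w * ψ (v + w) * (∑ s, ∑ y, ∑ z,
        A s * (A * η) y * (A * η⁻¹) z * ψ (s + y + z) *
          ψ (-(27 * x ^ 2 / (4 * (1 - x) ^ 3) * (s * y * z) / (v * w)))) =
      ∑ s, Fintype.card F * (A⁻¹ 27 * (A ^ 3) (1 - x)) * ((A ^ 3) s * V⁻¹ v * W⁻¹ w *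
        ψ (s * (1 - x) + v + w - x ^ 2 * s ^ 3 / (4 * v * w))) := by
    intro v w
    rcases eq_or_ne v 0 with rfl | hv
    · simp [MulChar.map_zero]
    rcases eq_or_ne w 0 with rfl | hw
    · simp [MulChar.map_zero]
    -- The cube `s³/27` cancels the `27` of the argument, and the scaling of `s` by `1 - x` cancels
    -- `(1 - x)³` and produces the factor `A³(1 - x)`.
    rw [sum_cubic_product hψ hη hη3 h3 hω A
      (fun u => ψ (-(27 * x ^ 2 / (4 * (1 - x) ^ 3) * u / (v * w)))),
      ← sum_mul_left_comp hx, Finset.mul_sum, Finset.mul_sum]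
    refine Finset.sum_congr rfl fun s _ => ?_
    have e : s * (1 - x) + v + w - x ^ 2 * s ^ 3 / (4 * v * w) = (v + w) + ((1 - x) * s +
        -(27 * x ^ 2 / (4 * (1 - x) ^ 3) * (((1 - x) * s) ^ 3 / 27) / (v * w))) := by
      field_simp
      ring
    rw [e, AddChar.map_add_eq_mul ψ (v + w), AddChar.map_add_eq_mul ψ ((1 - x) * s)]
    generalize ψ (v + w) = p
    generalize ψ ((1 - x) * s) = p'
    generalize ψ (-(27 * x ^ 2 / (4 * (1 - x) ^ 3) * (((1 - x) * s) ^ 3 / 27) / (v * w))) = p''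
    rw [MulChar.apply_div, map_pow, map_mul, MulChar.pow_apply' _ (by norm_num),
      MulChar.pow_apply' _ (by norm_num)]
    ring
  simp only [h1]
  rw [cubicExpSum]
  simp only [Finset.mul_sum]
  conv_rhs => rw [Finset.sum_comm]
  refine Finset.sum_congr rfl fun v _ => ?_
  rw [Finset.sum_comm]
  exact Finset.sum_congr rfl fun s _ => Finset.sum_congr rfl fun w _ => by ring

/-- The conditions on `V³` and `W³` make `V̄Aη` and `W̄Aη̄` nontrivial, as the expansion requires.
The Gauss sums left over from the Jacobi normalization are `g(A)g(Aη)g(Aη̄)`, which Hasse–Davenport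
collapses to `g(A³)`. -/
theorem mul_hypF_cubic (hψ : ψ.IsPrimitive) (hη : η ≠ 1) (hη3 : η ^ 3 = 1)
    (h2 : (2 : F) ≠ 0) (h3 : (3 : F) ≠ 0) {ω : F} (hω : ω ^ 2 + ω + 1 = 0)
    (hq : 2 < Fintype.card F) {A V W : MulChar F ℂ} (hA : A ^ 3 ≠ 1) (hV : V ^ 3 ≠ A ^ 3)
    (hW : W ^ 3 ≠ A ^ 3) {x : F} (hx : 1 - x ≠ 0) :
    (A⁻¹ ^ 3) (1 - x) * hypF 2 ![A, A * η, A * η⁻¹] ![V, W] (27 * x ^ 2 / (4 * (1 - x) ^ 3)) =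
      cubicExpSum ψ (A ^ 3) V⁻¹ W⁻¹ x /
        (gaussSum V⁻¹ ψ * gaussSum W⁻¹ ψ * gaussSum (A ^ 3) ψ) := by
  have hη3' : η⁻¹ ^ 3 = 1 := by rw [inv_pow, hη3, inv_one]
  have hA1 : A ≠ 1 := by rintro rfl; exact hA (one_pow 3)
  have hA2 : A * η ≠ 1 := fun h => hA (by rw [← one_pow 3, ← h, mul_pow, hη3, mul_one])
  have hA3 : A * η⁻¹ ≠ 1 := fun h => hA (by rw [← one_pow 3, ← h, mul_pow, hη3', mul_one])
  have hV1 : V⁻¹ * (A * η) ≠ 1 := by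
    intro h
    rw [inv_mul_eq_one] at h
    exact hV (by rw [h, mul_pow, hη3, mul_one])
  have hW1 : W⁻¹ * (A * η⁻¹) ≠ 1 := by
    intro h
    rw [inv_mul_eq_one] at h
    exact hW (by rw [h, mul_pow, hη3', mul_one])
  have hP := gaussSum_mul_hypP_cubic hψ hη hη3 h2 h3 hω hA1 hV1 hW1 hx
  have hHD := gaussSum_mul_gaussSum_cubic hψ hη hη3 h3 hω A
  have hJ1 := gaussSum_mul_jacobiSum hψ hA2 hV1
  have hJ2 := gaussSum_mul_jacobiSum hψ hA3 hW1
  have hF (t : F) : hypF 2 ![A, A * η, A * η⁻¹] ![V, W] t =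
      1 / (jacobiSum (A * η) (V * (A * η)⁻¹) * jacobiSum (A * η⁻¹) (W * (A * η⁻¹)⁻¹)) *
        hypP 2 ![A, A * η, A * η⁻¹] ![V, W] t := by
    simp [hypF, Fin.prod_univ_two]
  have e2 : (A * η) (-1) * (A * η⁻¹) (-1) = 1 := by
    simp only [MulChar.mul_apply, MulChar.inv_neg_one]
    linear_combination (A (-1) * A (-1)) * η.neg_one_mul_self + A.neg_one_mul_self
  have e3 : (A⁻¹ ^ 3) (1 - x) * (A ^ 3) (1 - x) = 1 := by
    rw [inv_pow, MulChar.inv_apply_mul_apply _ hx]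
  rw [hF]
  have nJ1 := jacobiSum_ne_zero hq hψ (A * η) (V * (A * η)⁻¹)
  have nJ2 := jacobiSum_ne_zero hq hψ (A * η⁻¹) (W * (A * η⁻¹)⁻¹)
  have nV := gaussSum_ne_zero hψ V⁻¹
  have nW := gaussSum_ne_zero hψ W⁻¹
  have nD := gaussSum_ne_zero hψ (A ^ 3)
  have nA := gaussSum_ne_zero hψ A
  have nVA := gaussSum_ne_zero hψ (V⁻¹ * (A * η))
  have nWA := gaussSum_ne_zero hψ (W⁻¹ * (A * η⁻¹))
  generalize hypP 2 ![A, A * η, A * η⁻¹] ![V, W] (27 * x ^ 2 / (4 * (1 - x) ^ 3)) = P at *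
  generalize jacobiSum (A * η) (V * (A * η)⁻¹) = J1 at *
  generalize jacobiSum (A * η⁻¹) (W * (A * η⁻¹)⁻¹) = J2 at *
  generalize cubicExpSum ψ (A ^ 3) V⁻¹ W⁻¹ x = L at *
  generalize gaussSum (V⁻¹ * (A * η)) ψ = gVA at *
  generalize gaussSum (W⁻¹ * (A * η⁻¹)) ψ = gWA at *
  generalize gaussSum (A * η) ψ = g1 at *
  generalize gaussSum (A * η⁻¹) ψ = g2 at *
  generalize gaussSum (A ^ 3) ψ = gD at *
  generalize gaussSum A ψ = gA at *
  generalize gaussSum V⁻¹ ψ = gV at *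
  generalize gaussSum W⁻¹ ψ = gW at *
  generalize (A⁻¹ ^ 3) (1 - x) = r at *
  generalize (A ^ 3) (1 - x) = r' at *
  have main : r * P * (gV * gW * gD) = L * (J1 * J2) := by
    apply mul_left_cancel₀ (mul_ne_zero (mul_ne_zero nA nVA) nWA)
    have hJ : gVA * gWA * (J1 * J2) = g1 * gV * (g2 * gW) := by
      linear_combination gWA * J2 * hJ1 + g1 * gV * (A * η) (-1) * hJ2 + g1 * gV * g2 * gW * e2
    linear_combination r * (gV * gW * gD) * hP - L * gA * hJ - L * gV * gW * hHD +
      Fintype.card F * A⁻¹ 27 * L * gV * gW * gD * e3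
  field_simp
  linear_combination main

end LeftSide

/-! ### The exponential sum at `x = 1` -/

section CubicCharacters

variable {F : Type*} [Field F] [Fintype F] {η : MulChar F ℂ}

theorem exists_generator_apply_ne_one (hη : η ≠ 1) :
    ∃ g : Fˣ, (∀ x, x ∈ Subgroup.zpowers g) ∧ η g ≠ 1 := by
  obtain ⟨g, hg⟩ := IsCyclic.exists_generator (α := Fˣ)
  refine ⟨g, hg, fun h => hη ((MulChar.eq_iff hg _ _).2 ?_)⟩
  rw [h, MulChar.one_apply g.isUnit]

theorem pow_three_eq_one_iff_of_cubic (hη : η ≠ 1) (hη3 : η ^ 3 = 1) (χ : MulChar F ℂ) :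
    χ ^ 3 = 1 ↔ χ = 1 ∨ χ = η ∨ χ = η⁻¹ := by
  constructor
  · intro h
    obtain ⟨g, hg, hg1⟩ := exists_generator_apply_ne_one hη
    have he := sq_add_self_add_one_eq_zero (MulChar.apply_pow_three hη3 g.ne_zero) hg1
    have ha := MulChar.apply_pow_three h g.ne_zero
    have hf : (χ g - 1) * ((χ g - η g) * (χ g - η g ^ 2)) = 0 := by
      linear_combination ha - (χ g - 1) * (χ g + 1 - η g) * he
    rw [MulChar.eq_iff hg, MulChar.eq_iff hg, MulChar.eq_iff hg, MulChar.one_apply g.isUnit,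
      MulChar.inv_apply_of_pow_three hη3 g.ne_zero]
    simpa [sub_eq_zero] using hf
  · rintro (rfl | rfl | rfl)
    · exact one_pow 3
    · exact hη3
    · rw [inv_pow, hη3, inv_one]

variable {ψ : AddChar F ℂ}

theorem gaussSum_triple_product (h2 : (2 : F) ≠ 0) (θ V W : MulChar F ℂ) :
    gaussSum θ ψ * gaussSum (V * θ) ψ * gaussSum (W * θ) ψ * θ (-4) =
      ∑ v, ∑ w, V v * W w * ∑ r, θ r * ψ (v + w - r / (4 * v * w)) := by
  have h4 := four_ne_zero_of_two h2
  rw [show gaussSum θ ψ * gaussSum (V * θ) ψ * gaussSum (W * θ) ψ * θ (-4) =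
    gaussSum (V * θ) ψ * (gaussSum (W * θ) ψ * (gaussSum θ ψ * θ (-4))) by ring]
  simp only [gaussSum]
  rw [Finset.sum_mul]
  refine Finset.sum_congr rfl fun v _ => ?_
  rw [Finset.sum_mul, Finset.mul_sum]
  refine Finset.sum_congr rfl fun w _ => ?_
  rcases eq_or_ne v 0 with rfl | hv
  · simp [MulChar.map_zero]
  rcases eq_or_ne w 0 with rfl | hw
  · simp [MulChar.map_zero]
  -- The substitution `r = -4vwu` makes the exponent `v + w + u` and distributes `θ(r)` over the
  -- three Gauss sums.
  have hc : -4 * v * w ≠ 0 := mul_ne_zero (mul_ne_zero (neg_ne_zero.2 h4) hv) hw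
  rw [Finset.sum_mul, Finset.mul_sum, Finset.mul_sum, ← sum_mul_left_comp hc (fun r => θ r * _),
    Finset.mul_sum]
  refine Finset.sum_congr rfl fun u _ => ?_
  have e : v + w - -4 * v * w * u / (4 * v * w) = v + w + u := by
    field_simp
    ring
  rw [e, AddChar.map_add_eq_mul, AddChar.map_add_eq_mul, map_mul, map_mul, map_mul,
    MulChar.mul_apply, MulChar.mul_apply]
  ring

variable [DecidableEq F]

theorem card_cube_roots (hη : η ≠ 1) (hη3 : η ^ 3 = 1) (h3 : (3 : F) ≠ 0) {ω : F}
    (hω : ω ^ 2 + ω + 1 = 0) (w : Fˣ) :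
    ((Finset.univ.filter fun s : Fˣ => s ^ 3 = w).card : ℂ) = 1 + η w + η⁻¹ w := by
  rw [MulChar.inv_apply_of_pow_three hη3 w.ne_zero]
  by_cases hw : ∃ s : Fˣ, s ^ 3 = w
  · obtain ⟨s, rfl⟩ := hw
    have h1 : η ((s ^ 3 : Fˣ) : F) = 1 := by
      rw [Units.val_pow_eq_pow_val, map_pow, MulChar.apply_pow_three hη3 s.ne_zero]
    have h2 : (Finset.univ.filter fun t : Fˣ => t ^ 3 = 1).card =
        (Finset.univ.filter fun t : Fˣ => t ^ 3 = s ^ 3).card := by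
      refine Finset.card_equiv (Equiv.mulRight s) fun t => ?_
      simp [mul_pow]
    rw [h1, ← h2, card_units_pow_three_eq_one hω h3]
    norm_num
  · have h0 : (Finset.univ.filter fun s : Fˣ => s ^ 3 = w) = ∅ :=
      Finset.filter_eq_empty_iff.2 fun s _ h => hw ⟨s, h⟩
    -- Since `η` is nontrivial at a generator, `η(w) = 1` would force the exponent of `w` to be
    -- divisible by `3`.
    have h1 : η w ≠ 1 := by
      intro h
      obtain ⟨g, hg, hg1⟩ := exists_generator_apply_ne_one hη
      have hg3 := MulChar.apply_pow_three hη3 g.ne_zero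
      obtain ⟨k, rfl⟩ := (mem_powers_iff_mem_zpowers (x := g)).2 (hg w)
      simp only [Units.val_pow_eq_pow_val, map_pow] at h
      rw [← Nat.div_add_mod k 3, pow_add, pow_mul, hg3, one_pow, one_mul] at h
      have hk : k % 3 < 3 := Nat.mod_lt _ (by norm_num)
      interval_cases hr : k % 3
      · exact hw ⟨g ^ (k / 3), by rw [← pow_mul, Nat.div_mul_cancel (Nat.dvd_of_mod_eq_zero hr)]⟩
      · exact hg1 (by simpa using h)
      · exact hg1 (by linear_combination hg3 - η g * h)
    rw [h0]
    have := sq_add_self_add_one_eq_zero (MulChar.apply_pow_three hη3 w.ne_zero) h1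
    simp only [Finset.card_empty, Nat.cast_zero]
    linear_combination -this

theorem sum_comp_cube (hη : η ≠ 1) (hη3 : η ^ 3 = 1) (h3 : (3 : F) ≠ 0) {ω : F}
    (hω : ω ^ 2 + ω + 1 = 0) (f : F → ℂ) (h0 : f 0 = 0) :
    ∑ s, f (s ^ 3) = ∑ r, (1 + η r + η⁻¹ r) * f r := by
  rw [sum_eq_sum_units _ (by simp [h0]),
    sum_eq_sum_units (fun r => (1 + η r + η⁻¹ r) * f r) (by simp [h0]),
    ← Finset.sum_fiberwise (s := (Finset.univ : Finset Fˣ)) (g := fun s : Fˣ => s ^ 3)]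
  refine Finset.sum_congr rfl fun w _ => ?_
  rw [← card_cube_roots hη hη3 h3 hω w, ← nsmul_eq_mul, ← Finset.sum_const]
  refine Finset.sum_congr rfl fun s hs => ?_
  rw [← (Finset.mem_filter.1 hs).2, Units.val_pow_eq_pow_val]

/-- With no linear term the summand depends on `s` only through `r = s³`, and the weight `1 + η(r) +
η̄(r)` counting cube roots splits the sum into the twists `A`, `Aη`, `Aη̄`. -/
theorem cubicExpSum_one (hη : η ≠ 1) (hη3 : η ^ 3 = 1) (h2 : (2 : F) ≠ 0) (h3 : (3 : F) ≠ 0)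
    {ω : F} (hω : ω ^ 2 + ω + 1 = 0) (A V W : MulChar F ℂ) :
    cubicExpSum ψ (A ^ 3) V W 1 =
      gaussSum A ψ * gaussSum (V * A) ψ * gaussSum (W * A) ψ * A (-4) +
      gaussSum (A * η) ψ * gaussSum (V * (A * η)) ψ * gaussSum (W * (A * η)) ψ * (A * η) (-4) +
      gaussSum (A * η⁻¹) ψ * gaussSum (V * (A * η⁻¹)) ψ * gaussSum (W * (A * η⁻¹)) ψ *
        (A * η⁻¹) (-4) := by
  rw [gaussSum_triple_product h2, gaussSum_triple_product h2, gaussSum_triple_product h2,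
    cubicExpSum, ← Finset.sum_add_distrib, ← Finset.sum_add_distrib, Finset.sum_comm]
  refine Finset.sum_congr rfl fun v _ => ?_
  rw [← Finset.sum_add_distrib, ← Finset.sum_add_distrib, Finset.sum_comm]
  refine Finset.sum_congr rfl fun w _ => ?_
  rw [← mul_add, ← mul_add, ← Finset.sum_add_distrib, ← Finset.sum_add_distrib]
  have h := sum_comp_cube hη hη3 h3 hω (fun r => A r * ψ (v + w - r / (4 * v * w)))
    (by simp [MulChar.map_zero])
  trans V v * W w * ∑ s, A (s ^ 3) * ψ (v + w - s ^ 3 / (4 * v * w))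
  · rw [Finset.mul_sum]
    refine Finset.sum_congr rfl fun s _ => ?_
    rw [sub_self, mul_zero, zero_add, one_pow, one_mul, map_pow,
      MulChar.pow_apply' _ (by norm_num)]
    ring
  · rw [h]
    congr 1
    refine Finset.sum_congr rfl fun r _ => ?_
    rw [MulChar.mul_apply, MulChar.mul_apply]
    ring

theorem cubicGaussTerm_eq (hη : η ≠ 1) (hη3 : η ^ 3 = 1) (h2 : (2 : F) ≠ 0) (h3 : (3 : F) ≠ 0)
    {ω : F} (hω : ω ^ 2 + ω + 1 = 0) (A B : MulChar F ℂ) :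
    cubicGaussTerm ψ A B =
      cubicExpSum ψ (A ^ 3) (phiChar F * B⁻¹) (A⁻¹ ^ 3 * B) 1 /
        (gaussSum (phiChar F * B⁻¹) ψ * gaussSum (A⁻¹ ^ 3 * B) ψ * gaussSum (A ^ 3) ψ) := by
  have hset : (Set.toFinite {χ : MulChar F ℂ | χ ^ 3 = A⁻¹ ^ 3}).toFinset =
      {A⁻¹, (A * η)⁻¹, (A * η⁻¹)⁻¹} := by
    ext χ
    have e : χ ^ 3 = A⁻¹ ^ 3 ↔ (χ * A) ^ 3 = 1 := by
      rw [mul_pow, ← eq_inv_iff_mul_eq_one, inv_pow]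
    have e1 (X : MulChar F ℂ) : χ = (A * X⁻¹)⁻¹ ↔ χ * A = X := by
      rw [mul_inv, inv_inv, mul_comm A⁻¹, eq_mul_inv_iff_mul_eq]
    have e2 : χ = (A * η)⁻¹ ↔ χ * A = η⁻¹ := by
      have := e1 η⁻¹
      rwa [inv_inv] at this
    have e3 : χ = A⁻¹ ↔ χ * A = 1 := eq_inv_iff_mul_eq_one
    simp only [Set.Finite.mem_toFinset, Set.mem_ofPred_eq, Finset.mem_insert,
      Finset.mem_singleton]
    rw [e, pow_three_eq_one_iff_of_cubic hη hη3, e3, e2, e1]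
    tauto
  have n1 : A⁻¹ ≠ (A * η)⁻¹ := by simpa using hη
  have n2 : A⁻¹ ≠ (A * η⁻¹)⁻¹ := by simpa using hη
  have n3 : (A * η)⁻¹ ≠ (A * η⁻¹)⁻¹ := by
    intro h
    have h' : η = η⁻¹ := mul_left_cancel (inv_injective h)
    apply hη
    rw [eq_inv_iff_mul_eq_one] at h'
    rw [← hη3, pow_three, h', mul_one]
  have n12 : A⁻¹ ∉ ({(A * η)⁻¹, (A * η⁻¹)⁻¹} : Finset (MulChar F ℂ)) := by
    simp only [Finset.mem_insert, Finset.mem_singleton, not_or]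
    exact ⟨n1, n2⟩
  rw [cubicGaussTerm, hset, Finset.sum_insert n12, Finset.sum_insert (by simpa using n3),
    Finset.sum_singleton, cubicExpSum_one hη hη3 h2 h3 hω]
  have hV (X : MulChar F ℂ) : phiChar F * (B * X⁻¹)⁻¹ = phiChar F * B⁻¹ * X := by
    rw [mul_inv, inv_inv, mul_assoc]
  have hW (X : MulChar F ℂ) : B * (A ^ 3 * X⁻¹)⁻¹ = A⁻¹ ^ 3 * B * X := by
    rw [mul_inv, inv_inv, inv_pow, ← mul_assoc, mul_comm B]
  simp only [hV, hW, inv_inv]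
  ring

end CubicCharacters

/-! ### Special values, existence facts and the main theorem -/

/-- At `0` the innermost factor is the constant `1`, so each integration produces exactly its
normalizing Jacobi sum. -/
theorem hypF_zero {F : Type*} [Field F] [Fintype F] (n : ℕ) (A : Fin (n + 1) → MulChar F ℂ)
    (B : Fin n → MulChar F ℂ) (hJ : ∀ α β : MulChar F ℂ, jacobiSum α β ≠ 0) :
    hypF n A B 0 = 1 := by
  have h : hypP n A B 0 = ∏ i : Fin n, jacobiSum (A i.succ) (B i * (A i.succ)⁻¹) := by
    induction n with
    | zero => simp [hypP]
    | succ n ih =>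
      simp only [hypP, zero_mul, ih]
      rw [← Finset.sum_mul, Fin.prod_univ_castSucc, mul_comm]
      congr 1
      rw [Fin.succ_last, mul_comm (B (Fin.last n))]
      rfl
  rw [hypF, h, one_div, inv_mul_cancel₀]
  exact Finset.prod_ne_zero_iff.2 fun i _ => hJ _ _

theorem traceChar_isPrimitive (p : ℕ) [Fact p.Prime] (F : Type*) [Field F] [Fintype F]
    [Algebra (ZMod p) F] {ζ : ℂ} (hζ : IsPrimitiveRoot ζ p) : (traceChar p F hζ).IsPrimitive := by
  refine AddChar.IsPrimitive.of_ne_one fun h => ?_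
  obtain ⟨a, ha⟩ := Algebra.trace_surjective (ZMod p) F 1
  have h1 : traceChar p F hζ a = 1 := by rw [h, AddChar.one_apply]
  have hp : 1 < p := (Fact.out : p.Prime).one_lt
  have : Fact (1 < p) := ⟨hp⟩
  rw [traceChar_apply, ha, ZMod.val_one, pow_one] at h1
  exact hζ.ne_one hp h1

theorem natCast_ne_zero_of_card_modEq {F : Type*} [Field F] [Fintype F] {n k : ℕ}
    (h : Fintype.card F ≡ 1 [MOD n]) (hk : k ∣ n) : (k : F) ≠ 0 := by
  intro h0
  obtain ⟨m, hm⟩ := (Nat.modEq_iff_dvd' Fintype.card_pos).1 (h.of_dvd hk).symm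
  have h1 : Fintype.card F = 1 + k * m := by
    have := Fintype.card_pos (α := F)
    omega
  have h2 := Nat.cast_card_eq_zero F
  rw [h1] at h2
  push_cast at h2
  rw [h0, zero_mul, add_zero] at h2
  exact one_ne_zero h2

theorem exists_cube_root_of_one {F : Type*} [Field F] [Fintype F]
    (h : Fintype.card F ≡ 1 [MOD 3]) : ∃ ω : F, ω ^ 2 + ω + 1 = 0 := by
  classical
  have hd : 3 ∣ Fintype.card Fˣ := by
    rw [Fintype.card_units]
    exact (Nat.modEq_iff_dvd' Fintype.card_pos).1 h.symm
  have : Fact (Nat.Prime 3) := ⟨Nat.prime_three⟩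
  obtain ⟨u, hu⟩ := exists_prime_orderOf_dvd_card 3 hd
  refine ⟨u, sq_add_self_add_one_eq_zero ?_ fun h1 => ?_⟩
  · rw [← Units.val_pow_eq_pow_val, ← hu, pow_orderOf_eq_one, Units.val_one]
  · rw [Units.val_eq_one] at h1
    rw [h1, orderOf_one] at hu
    norm_num at hu

theorem mainTheorem6 (p : ℕ) [Fact p.Prime] {F : Type*} [Field F] [Fintype F] [DecidableEq F]
    [Algebra (ZMod p) F] (hq : Fintype.card F ≡ 1 [MOD 6])
    {ζ : ℂ} (hζ : IsPrimitiveRoot ζ p)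
    (η A B : MulChar F ℂ) (hη : orderOf η = 3)
    (h1 : A ^ 3 ≠ 1) (h2 : B ≠ 1) (h3 : A ^ 3 * (B⁻¹) ^ 2 ≠ 1) (h4 : A ^ 6 * (B⁻¹) ^ 3 ≠ 1)
    (h5 : phiChar F * A ^ 3 * B⁻¹ ≠ 1) (h6 : phiChar F * A ^ 3 * (B⁻¹) ^ 3 ≠ 1) :
    (∀ x : F,
      ((A⁻¹) ^ 3) (1 - x) *
          hypF 2 ![A, A * η, A * η⁻¹] ![phiChar F * B, A ^ 3 * B⁻¹]
            (27 * x ^ 2 / (4 * (1 - x) ^ 3)) =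
        hypF 2 ![A ^ 3, B, phiChar F * A ^ 3 * B⁻¹] ![B ^ 2, A ^ 6 * (B⁻¹) ^ 2] (4 * x)
        - ffDelta (x + 2) *
            (gaussSum (phiChar F) (traceChar p F hζ) *
                gaussSum ((A⁻¹) ^ 3) (traceChar p F hζ) /
              (gaussSum (phiChar F * B⁻¹) (traceChar p F hζ) *
                gaussSum ((A⁻¹) ^ 3 * B) (traceChar p F hζ)))
        - ffDelta (1 - x) * cubicGaussTerm (traceChar p F hζ) A B) ∧
    hypF 2 ![A ^ 3, B, phiChar F * A ^ 3 * B⁻¹] ![B ^ 2, A ^ 6 * (B⁻¹) ^ 2] (4 : F) =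
      cubicGaussTerm (traceChar p F hζ) A B := by
  have hψ := traceChar_isPrimitive p F hζ
  -- Only primitivity of the additive character is needed from here on.
  generalize traceChar p F hζ = ψ at hψ ⊢
  have two : (2 : F) ≠ 0 := by exact_mod_cast natCast_ne_zero_of_card_modEq hq (k := 2) (by decide)
  have three : (3 : F) ≠ 0 := by
    exact_mod_cast natCast_ne_zero_of_card_modEq hq (k := 3) (by decide)
  obtain ⟨ω, hω⟩ := exists_cube_root_of_one (F := F) (hq.of_dvd (by decide))
  have hη3 : η ^ 3 = 1 := by rw [← hη, pow_orderOf_eq_one]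
  have hη1 : η ≠ 1 := by
    rintro rfl
    rw [orderOf_one] at hη
    norm_num at hη
  have hcard : 2 < Fintype.card F := by
    have h := Fintype.one_lt_card (α := F)
    by_contra h'
    have : Fintype.card F = 2 := by omega
    rw [this] at hq
    exact absurd hq (by decide)
  have hφ2 : phiChar F ^ 2 = 1 := phiChar_isQuadratic.sq_eq_one
  -- In terms of `C` the right side has the symmetric shape `φBC, B, C; B², C²`, and `Ā³B = φC̄`.
  set C := phiChar F * A ^ 3 * B⁻¹ with hC
  have hD : A ^ 3 = phiChar F * B * C := by
    rw [hC, show phiChar F * B * (phiChar F * A ^ 3 * B⁻¹) =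
      phiChar F ^ 2 * (B * B⁻¹) * A ^ 3 by rw [sq]; ac_rfl, hφ2, mul_inv_cancel, one_mul, one_mul]
  have hC2 : A ^ 6 * B⁻¹ ^ 2 = C ^ 2 := by
    rw [hC, mul_pow, mul_pow, hφ2, one_mul, ← pow_mul]
  have hW : (A ^ 3 * B⁻¹)⁻¹ = phiChar F * C⁻¹ := by
    rw [hC, mul_assoc (phiChar F), mul_inv (phiChar F), phiChar_inv, ← mul_assoc,
      phiChar_mul_self, one_mul]
  have hW' : A⁻¹ ^ 3 * B = phiChar F * C⁻¹ := by
    rw [← hW, mul_inv, inv_inv, inv_pow]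
  have hV : (phiChar F * B)⁻¹ = phiChar F * B⁻¹ := by rw [mul_inv, phiChar_inv]
  have hBC : phiChar F * B⁻¹ * C ≠ 1 := by
    rw [hC, show phiChar F * B⁻¹ * (phiChar F * A ^ 3 * B⁻¹) =
      phiChar F ^ 2 * (A ^ 3 * B⁻¹ ^ 2) by rw [sq, sq]; ac_rfl, hφ2, one_mul]
    exact h3
  have hV3 : (phiChar F * B) ^ 3 ≠ A ^ 3 := by
    intro h
    apply h6
    rw [← h, mul_pow, pow_succ (phiChar F), hφ2, one_mul, ← mul_assoc, phiChar_mul_self, one_mul,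
      inv_pow, mul_inv_cancel]
  have hW3 : (A ^ 3 * B⁻¹) ^ 3 ≠ A ^ 3 := by
    intro h
    apply h4
    rw [mul_pow, ← pow_mul, show 3 * 3 = 3 + 6 by norm_num, pow_add, mul_assoc] at h
    exact mul_eq_left.1 h
  have right : ∀ x : F, x ≠ 0 → hypF 2 ![A ^ 3, B, C] ![B ^ 2, A ^ 6 * B⁻¹ ^ 2] (4 * x) =
      cubicExpSum ψ (A ^ 3) (phiChar F * B⁻¹) (A⁻¹ ^ 3 * B) x /
        (gaussSum (phiChar F * B⁻¹) ψ * gaussSum (A⁻¹ ^ 3 * B) ψ * gaussSum (A ^ 3) ψ) +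
      ffDelta (x + 2) * (gaussSum (phiChar F) ψ * gaussSum (A⁻¹ ^ 3) ψ /
        (gaussSum (phiChar F * B⁻¹) ψ * gaussSum (A⁻¹ ^ 3 * B) ψ)) := by
    intro x hx
    have := hypF_sq_eq hψ two hcard hx h2 h5 (hD ▸ h1) hBC
    rw [← hD] at this
    rw [hC2, hW', inv_pow, this]
  have atOne : hypF 2 ![A ^ 3, B, C] ![B ^ 2, A ^ 6 * B⁻¹ ^ 2] (4 : F) = cubicGaussTerm ψ A B := by
    have h := right 1 one_ne_zero
    have h12 : (1 : F) + 2 ≠ 0 := by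
      rw [show (1 : F) + 2 = 3 by norm_num]
      exact three
    rw [mul_one, ffDelta, if_neg h12, zero_mul, add_zero] at h
    rw [h, cubicGaussTerm_eq hη1 hη3 two three hω]
  refine ⟨fun x => ?_, atOne⟩
  -- The kernel computation requires `x ≠ 0`; at `0` both functions are `1` and both delta terms
  -- vanish.
  rcases eq_or_ne x 0 with rfl | hx
  · have hz : ∀ α β : MulChar F ℂ, jacobiSum α β ≠ 0 := jacobiSum_ne_zero hcard hψ
    simp [hypF_zero _ _ _ hz, ffDelta, two]
  -- Here the argument is a division by zero, but its value is irrelevant because `Ā³(0) = 0`; what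
  -- remains is the evaluation at `4`.
  rcases eq_or_ne x 1 with rfl | hx1
  · have h12 : (1 : F) + 2 ≠ 0 := by
      rw [show (1 : F) + 2 = 3 by norm_num]
      exact three
    rw [mul_one, atOne, sub_self, MulChar.map_zero, ffDelta, ffDelta, if_neg h12, if_pos rfl]
    ring
  have hx1' : 1 - x ≠ 0 := sub_ne_zero.2 hx1.symm
  rw [mul_hypF_cubic hψ hη1 hη3 two three hω hcard h1 hV3 hW3 hx1', right x hx, hV, hW, hW']
  simp only [ffDelta, if_neg hx1']
  ring
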